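/- Let $T$ be a complete first-order theory in a countable language and let $M$ be a saturated model of $T$ with $|M|>2^{\aleph_0}$. Let $\mathrm{Autf}(M)$ be the (normal) subgroup of $\mathrm{Aut}(M)$ generated by the automorphisms that fix some elementary substructure $N\prec M$ pointwise, and let $\mathrm{Gal}(T)=\mathrm{Aut}(M)/\mathrm{Autf}(M)$. Let $n\le\omega$. An ultra-imaginary element is a class $a/E$ where $a\in M^n$ and $E$ is an $\mathrm{Aut}(M)$-invariant equivalence relation on $M^n$. It is hyperimaginary if $E$ is defined by a (possibly infinite) conjunction of first-order formulas without parameters, imaginary if $n<\omega$ and $E$ is defined by one formula without parameters, and finitary if $n<\omega$. It is bounded if its $\mathrm{Aut}(M)$-orbit has at most $2^{\aleph_0}$ elements; an invariant equivalence relation $E$ is bounded if it has at most $2^{\aleph_0}$ classes. If $E$ is bounded, the logic topology on $M^n/E$ has as closed sets those $X$ whose preimage in $M^n$ is an intersection of at most $2^{\aleph_0}$ subsets of $M^n$ definable with parameters. Then $\mathrm{Autf}(M)$ fixes every bounded ultra-imaginary element, so that $\mathrm{Gal}(T)$ acts on the set of these elements. Give $\mathrm{Gal}(T)$ the coarsest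 topology for which all the maps $\gamma\mapsto\gamma\alpha$ from $\mathrm{Gal}(T)$ to $M^n/E$ are continuous, where $n\le\omega$, $E$ is a bounded invariant equivalence relation on $M^n$, $\alpha\in M^n/E$, and $M^n/E$ has the logic topology. For a family $(f_i)_{i\in I}$ in $\mathrm{Aut}(M)$ and an ultrafilter $\mathcal U$ on $I$, there is exactly one $\beta\in\mathrm{Gal}(T)$ that acts on the bounded classes $a/E$ ($E$ a bounded invariant equivalence relation) as the automorphism $\prod_{\mathcal U}f_i$ of the ultrapower $M^I/\mathcal U$ acts on the corresponding classes of the ultrapower (modulo the relation given by the same complete types over $\emptyset$ as $E$). A set $X\subseteq\mathrm{Gal}(T)$ is closed in the above topology if and only if it contains this $\beta$ for all $I$, all $\mathcal U$ and all families $(f_i)$ such that the class of each $f_i$ in $\mathrm{Gal}(T)$ belongs to $X$. Moreover: 1. $\mathrm{Gal}(T)$ is a topological group and is compact (not necessarily Hausdorff). 2. $\mathrm{Gal}(T)$ is Hausdorff if and only if it acts faithfully on the set of bounded hyperimaginary elements, if and only if it acts faithfully on the set of finitary bounded hyperimaginary elements. 3. $\mathrm{Gal}(T)$ is profinite (a compact,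 Hausdorff, totally disconnected topological group) if and only if it acts faithfully on the set of bounded imaginary elements. -/

import Mathlib

open FirstOrder Cardinal

universe u v w

/-! ### The automorphism group, strong automorphisms, and the quotient group -/

section Automorphisms

variable {L : FirstOrder.Language.{u, v}} {M : Type w} [L.Structure M]

/-- The automorphism group of an `L`-structure; multiplication is composition. -/
instance autGroup : Group (M ≃[L] M) where
  mul f g := f.comp g
  one := FirstOrder.Language.Equiv.refl L M
  inv f := f.symm
  mul_assoc _ _ _ := rfl
  one_mul _ := rfl
  mul_one _ := rfl
  inv_mul_cancel f := FirstOrder.Language.Equiv.ext fun x => f.symm_apply_apply x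

theorem aut_mul_apply (f g : M ≃[L] M) (x : M) : (f * g) x = f (g x) := rfl

theorem aut_one_apply (x : M) : (1 : M ≃[L] M) x = x := rfl

theorem aut_inv_apply_self (f : M ≃[L] M) (x : M) : f⁻¹ (f x) = x := f.symm_apply_apply x

theorem aut_apply_inv_self (f : M ≃[L] M) (x : M) : f (f⁻¹ x) = x := f.apply_symm_apply x

variable (L M) in
/-- The group of strong automorphisms: the subgroup generated by all automorphisms that fix
pointwise some elementary substructure. -/
def Autf : Subgroup (M ≃[L] M) :=
  Subgroup.closure {f | ∃ N : L.ElementarySubstructure M, ∀ x ∈ N, f x = x}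

/-- The image of an elementary substructure under an automorphism. -/
def elementaryImage (g : M ≃[L] M) (N : L.ElementarySubstructure M) :
    L.ElementarySubstructure M where
  toSubstructure := N.toSubstructure.map g.toEmbedding.toHom
  isElementary' := by
    intro n φ x
    let e := g.toEmbedding.substructureEquivMap N.toSubstructure
    have hx : (((↑) : _ → M) ∘ x) = g ∘ (((↑) : _ → M) ∘ (e.symm ∘ x)) := by
      funext i
      have h1 : ((e (e.symm (x i)) : _) : M) = g ((e.symm (x i) : _) : M) := rfl
      rw [e.apply_symm_apply] at h1
      exact h1
    have h2 : φ.Realize (((↑) : _ → M) ∘ (e.symm ∘ x)) ↔ φ.Realize (e.symm ∘ x) :=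
      N.isElementary' φ (e.symm ∘ x)
    rw [hx, FirstOrder.Language.StrongHomClass.realize_formula g, h2]
    exact FirstOrder.Language.StrongHomClass.realize_formula e.symm φ

instance autf_normal : (Autf L M).Normal := by
  refine ⟨fun f hf g => ?_⟩
  unfold Autf at hf ⊢
  induction hf using Subgroup.closure_induction with
  | mem f hf =>
    obtain ⟨N, hN⟩ := hf
    refine Subgroup.subset_closure ⟨elementaryImage g N, ?_⟩
    rintro _ ⟨y, hy, rfl⟩
    change (g * f * g⁻¹) (g y) = g y
    rw [aut_mul_apply, aut_mul_apply, aut_inv_apply_self, hN y hy]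
  | one => simp
  | mul a b _ _ ha hb =>
    have : g * (a * b) * g⁻¹ = (g * a * g⁻¹) * (g * b * g⁻¹) := by group
    rw [this]
    exact Subgroup.mul_mem _ ha hb
  | inv a _ ha =>
    have : g * a⁻¹ * g⁻¹ = (g * a * g⁻¹)⁻¹ := by group
    rw [this]
    exact Subgroup.inv_mem _ ha

variable (L M) in
/-- `Gal = Aut(M) / Autf(M)`. -/
def Gal : Type w := (M ≃[L] M) ⧸ Autf L M

noncomputable instance galGroup : Group (Gal L M) :=
  inferInstanceAs (Group ((M ≃[L] M) ⧸ Autf L M))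

/-- The class of an automorphism in `Gal`. -/
def Gal.mk (f : M ≃[L] M) : Gal L M := QuotientGroup.mk f

variable (L M) in
/-- `M` is saturated: for each `A ⊆ M` with `|A| < |M|`, each set of formulas in one variable with
parameters in `A` that is finitely satisfiable in `M` is realized in `M`. -/
def IsSaturated : Prop :=
  ∀ A : Set M, #A < #M → ∀ p : Set (L[[A]].Formula Unit),
    (∀ q : Finset (L[[A]].Formula Unit), ↑q ⊆ p → ∃ x : M, ∀ φ ∈ q, φ.Realize fun _ => x) →
      ∃ x : M, ∀ φ ∈ p, φ.Realize fun _ => x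

end Automorphisms

/-! ### Ultra-imaginary, hyperimaginary and imaginary elements -/

section Imaginaries

/-- An equivalence relation on the tuples of `M` indexed by `ι` that is invariant under `Aut(M)`.
Tuples of length `n ≤ ω` correspond to countable index types `ι`. -/
structure InvEquiv (L : FirstOrder.Language.{u, v}) (M : Type w) [L.Structure M] (ι : Type) extends
    Setoid (ι → M) where
  invariant : ∀ (f : M ≃[L] M) (a b : ι → M), r a b → r (f ∘ a) (f ∘ b)

namespace InvEquiv

variable {L : FirstOrder.Language.{u, v}} {M : Type w} [L.Structure M] {ι : Type}

/-- The classes modulo `E`, that is, the ultra-imaginary elements given by `E`. -/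
def Classes (E : InvEquiv L M ι) : Type w := Quotient E.toSetoid

/-- The class of a tuple. -/
def cls (E : InvEquiv L M ι) (a : ι → M) : E.Classes := Quotient.mk E.toSetoid a

/-- The action of `Aut(M)` on the classes modulo an invariant equivalence relation:
`f • (a / E) = f(a) / E`. -/
instance (E : InvEquiv L M ι) : MulAction (M ≃[L] M) E.Classes where
  smul f := Quotient.map (fun a => f ∘ a) (E.invariant f)
  one_smul α := by
    induction α using Quotient.inductionOn
    rfl
  mul_smul f g α := by
    induction α using Quotient.inductionOn
    rfl

/-- `E` is bounded: it has at most `2 ^ ℵ₀` classes. -/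
def IsBounded (E : InvEquiv L M ι) : Prop := #E.Classes ≤ 𝔠

/-- `E` is defined by a (possibly infinite) conjunction of first-order formulas without
parameters. -/
def IsTypeDefinable (E : InvEquiv L M ι) : Prop :=
  ∃ S : Set (L.Formula (ι ⊕ ι)), ∀ a b : ι → M, E.r a b ↔ ∀ φ ∈ S, φ.Realize (Sum.elim a b)

/-- `E` is defined by one first-order formula without parameters. -/
def IsDefinable (E : InvEquiv L M ι) : Prop :=
  ∃ φ : L.Formula (ι ⊕ ι), ∀ a b : ι → M, E.r a b ↔ φ.Realize (Sum.elim a b)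

/-- An ultra-imaginary element is bounded if its orbit has at most `2 ^ ℵ₀` elements. -/
def IsBoundedElt {E : InvEquiv L M ι} (α : E.Classes) : Prop :=
  #(MulAction.orbit (M ≃[L] M) α) ≤ 𝔠

/-- A set `X` of classes is closed in the logic topology: its preimage is the intersection of a
family of sets definable with parameters. The family has to be small, which means here at most
`2 ^ ℵ₀` sets (equivalently, at most `2 ^ ℵ₀` parameters). -/
def IsLogicClosed (E : InvEquiv L M ι) (X : Set E.Classes) : Prop :=
  ∃ S : Set (Set (ι → M)), #S ≤ 𝔠 ∧ (∀ s ∈ S, (Set.univ : Set M).Definable L s) ∧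
    E.cls ⁻¹' X = ⋂₀ S

/-- The logic topology on the classes of a bounded invariant equivalence relation. -/
@[reducible] def logicTopology (E : InvEquiv L M ι) (hE : E.IsBounded) : TopologicalSpace E.Classes :=
  TopologicalSpace.ofClosed {X | E.IsLogicClosed X}
    (by
      refine ⟨{∅}, ?_, ?_, by simp⟩
      · rw [mk_singleton]
        exact one_le_aleph0.trans aleph0_le_continuum
      · rintro s rfl
        exact Set.definable_empty)
    (by
      intro F hF
      -- for each class outside the intersection pick a member of `F` that omits it
      have hex : ∀ α : {α : E.Classes // α ∉ ⋂₀ F}, ∃ X ∈ F, α.1 ∉ X := by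
        intro α
        simpa [Set.mem_sInter] using α.2
      choose X hXF hX using hex
      choose S hSc hSd hS using fun α => hF (hXF α)
      refine ⟨⋃ α, S α, ?_, ?_, ?_⟩
      · refine (mk_iUnion_le _).trans ?_
        refine (mul_le_mul' ((mk_subtype_le _).trans hE) (ciSup_le' hSc)).trans ?_
        exact (mul_eq_self aleph0_le_continuum).le
      · intro s hs
        obtain ⟨α, hα⟩ := Set.mem_iUnion.1 hs
        exact hSd α s hα
      · ext a
        rw [Set.sInter_iUnion, Set.mem_iInter]
        constructor
        · intro ha α
          rw [← hS α]
          exact ha _ (hXF α)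
        · intro ha
          by_contra hn
          have h := ha ⟨E.cls a, hn⟩
          rw [← hS] at h
          exact hX _ h)
    (by
      rintro X ⟨S, hSc, hSd, hS⟩ Y ⟨R, hRc, hRd, hR⟩
      refine ⟨Set.image2 (· ∪ ·) S R, ?_, ?_, ?_⟩
      · refine mk_image2_le.trans ?_
        exact (mul_le_mul' hSc hRc).trans (mul_eq_self aleph0_le_continuum).le
      · rintro _ ⟨s, hs, t, ht, rfl⟩
        exact (hSd s hs).union (hRd t ht)
      · rw [Set.preimage_union, hS, hR]
        ext a
        simp only [Set.mem_union, Set.mem_sInter, Set.mem_image2]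
        constructor
        · rintro (h | h) _ ⟨s, hs, t, ht, rfl⟩
          · exact Or.inl (h s hs)
          · exact Or.inr (h t ht)
        · intro h
          by_contra hn
          push Not at hn
          obtain ⟨⟨s, hs, has⟩, t, ht, hat⟩ := hn
          exact (h _ ⟨s, hs, t, ht, rfl⟩).elim has hat)

end InvEquiv

end Imaginaries

/-! ### The action and the topology of `Gal` -/

section Topology

variable {L : FirstOrder.Language.{u, v}} {M : Type w} [L.Structure M]

/-- The action of `Gal` on bounded ultra-imaginary elements: `γ` acts as any automorphism that
lifts it. On bounded elements the result does not depend on the lift; this independence is part of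
the theorem. -/
noncomputable def galAct {ι : Type} {E : InvEquiv L M ι} (γ : Gal L M) (α : E.Classes) :
    E.Classes :=
  (Quotient.out γ : M ≃[L] M) • α

/-- The coarsest topology on `Gal` for which all the maps `γ ↦ γ • α` to `M ^ n / E` are
continuous, where `n ≤ ω`, `E` is a bounded invariant equivalence relation on `M ^ n`, `α` is a
class modulo `E`, and `M ^ n / E` has the logic topology. -/
noncomputable instance galTopology : TopologicalSpace (Gal L M) :=
  ⨅ (ι : Type) (_ : Countable ι) (E : InvEquiv L M ι) (hE : E.IsBounded) (α : E.Classes),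
    TopologicalSpace.induced (fun γ : Gal L M => galAct γ α) (E.logicTopology hE)

/-- The ultrapower of `M` along `U`. -/
abbrev Ultrapower {I : Type w} (U : Ultrafilter I) (M : Type w) : Type w :=
  (U : Filter I).Product fun _ : I => M

/-- The ultraproduct `∏_U f i` of a family of automorphisms, as a map of the ultrapower. -/
def ultraMap {I : Type w} (U : Ultrafilter I) (f : I → (M ≃[L] M)) :
    Ultrapower U M → Ultrapower U M :=
  Quotient.map' (s₁ := (U : Filter I).productSetoid fun _ => M)
    (s₂ := (U : Filter I).productSetoid fun _ => M) (fun x i => f i (x i))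
    fun _ _ h => Filter.mem_of_superset h fun i hi => congrArg (f i) hi

/-- The ultraproduct `∏_U f i` of a family of automorphisms of `M`, an automorphism of the
ultrapower. -/
def ultraAut {I : Type w} (U : Ultrafilter I) (f : I → (M ≃[L] M)) :
    Ultrapower U M ≃[L] Ultrapower U M where
  toFun := ultraMap U f
  invFun := ultraMap U fun i => (f i)⁻¹
  left_inv x := by
    induction x using Quotient.inductionOn' with
    | h x => exact congrArg _ (funext fun i => aut_inv_apply_self (f i) (x i))
  right_inv x := by
    induction x using Quotient.inductionOn' with
    | h x => exact congrArg _ (funext fun i => aut_apply_inv_self (f i) (x i))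
  map_fun' {n} F x := by
    choose y hy using fun k => Quotient.exists_rep (x k)
    obtain rfl : (fun k => Quotient.mk _ (y k)) = x := funext hy
    exact (congrArg (ultraMap U f)
        (FirstOrder.Language.Ultraproduct.funMap_cast (u := U) (M := fun _ : I => M) F y)).trans
      ((congrArg _ (funext fun i => (f i).map_fun F fun k => y k i)).trans
        (FirstOrder.Language.Ultraproduct.funMap_cast (u := U) (M := fun _ : I => M) F
          fun k i => f i (y k i)).symm)
  map_rel' {n} R x := by
    choose y hy using fun k => Quotient.exists_rep (x k)
    obtain rfl : (fun k => Quotient.mk _ (y k)) = x := funext hy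
    have key : ∀ z : Fin n → I → M,
        FirstOrder.Language.Structure.RelMap R (fun k => ((z k : I → M) : Ultrapower U M)) ↔
          ∀ᶠ i in (U : Filter I), FirstOrder.Language.Structure.RelMap R fun k => z k i := fun z =>
      (FirstOrder.Language.relMap_quotient_mk' (s := (U : Filter I).productSetoid fun _ : I => M)
        (ps := FirstOrder.Language.Ultraproduct.setoidPrestructure (fun _ : I => M) U) R z)
    exact (key fun k i => f i (y k i)).trans
      ((Filter.eventually_congr (Filter.Eventually.of_forall fun i =>
        (f i).map_rel R fun k => y k i)).trans (key y).symm)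

/-- The diagonal embedding of `M` into the ultrapower. -/
def diag {I : Type w} (U : Ultrafilter I) (x : M) : Ultrapower U M :=
  Quotient.mk' (s := (U : Filter I).productSetoid fun _ => M) fun _ => x

/-- The relation on the ultrapower induced by an invariant relation `E` on `M`: an invariant
relation is determined by a set of complete types, namely those realized by `(a, b)` with
`E a b`, and the induced relation is given by the same types. -/
def ultraRel {I : Type w} (U : Ultrafilter I) {ι : Type} (E : InvEquiv L M ι)
    (x y : ι → Ultrapower U M) : Prop :=
  ∃ a b : ι → M, E.r a b ∧
    ∀ φ : L.Formula (ι ⊕ ι), φ.Realize (Sum.elim x y) ↔ φ.Realize (Sum.elim a b)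

/-- `β` is the element of `Gal` defined by the automorphism `∏_U f i` of the ultrapower: for each
bounded ultra-imaginary `a / E`, the automorphism `∏_U f i` maps the class that corresponds to
`a / E` to the class that corresponds to `β • (a / E)`. That such a `β` exists and is unique is part
of the theorem. -/
def IsUltraLimit {I : Type w} (U : Ultrafilter I) (f : I → (M ≃[L] M)) (β : Gal L M) : Prop :=
  ∃ g : M ≃[L] M, Gal.mk g = β ∧
    ∀ (ι : Type) [Countable ι] (E : InvEquiv L M ι), E.IsBounded → ∀ a : ι → M,
      ultraRel U E (fun k => ultraAut U f (diag U (a k))) (fun k => diag U (g (a k)))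

/-- A set is closed under limits along ultrafilters of families of its elements, for all choices of
automorphisms lifting the family. -/
def IsUltraClosed (X : Set (Gal L M)) : Prop :=
  ∀ (I : Type w) (U : Ultrafilter I) (f : I → (M ≃[L] M)) (β : Gal L M),
    (∀ i, Gal.mk (f i) ∈ X) → IsUltraLimit U f β → β ∈ X

variable (L M) in
/-- `Gal` acts faithfully on the set of bounded hyperimaginary elements. -/
def FaithfulOnBddHyperimaginaries : Prop :=
  ∀ γ : Gal L M,
    (∀ (ι : Type) [Countable ι] (E : InvEquiv L M ι), E.IsTypeDefinable →
      ∀ α : E.Classes, InvEquiv.IsBoundedElt α → galAct γ α = α) → γ = 1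

variable (L M) in
/-- `Gal` acts faithfully on the set of finitary bounded hyperimaginary elements. -/
def FaithfulOnFinitaryBddHyperimaginaries : Prop :=
  ∀ γ : Gal L M,
    (∀ (ι : Type) [Finite ι] (E : InvEquiv L M ι), E.IsTypeDefinable →
      ∀ α : E.Classes, InvEquiv.IsBoundedElt α → galAct γ α = α) → γ = 1

variable (L M) in
/-- `Gal` acts faithfully on the set of bounded imaginary elements. -/
def FaithfulOnBddImaginaries : Prop :=
  ∀ γ : Gal L M,
    (∀ (ι : Type) [Finite ι] (E : InvEquiv L M ι), E.IsDefinable →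
      ∀ α : E.Classes, InvEquiv.IsBoundedElt α → galAct γ α = α) → γ = 1

/-- A topological group is profinite if it is compact, Hausdorff and totally disconnected. -/
def IsProfinite (G : Type w) [Group G] [TopologicalSpace G] : Prop :=
  IsTopologicalGroup G ∧ CompactSpace G ∧ T2Space G ∧ TotallyDisconnectedSpace G

end Topology

/-! Everything is read off from types over one countable model. Let `n` enumerate a countable
elementary substructure. An automorphism fixing `n` is strong, so the class of `f` in `Gal L M`
depends only on the type of `f ∘ n` over `n`, and compactness of the type space passes to the group.
By saturation and homogeneity, the limit along an ultrafilter of the types of `f i ∘ n` over `n` is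
the type of some `g ∘ n`. This is `LimAt`, and it computes the ultraproduct action on all bounded
classes (`LimAt.exists_r`). Bounded classes are insensitive to `Autf` because tuples with the same
type over a countable model are equivalent: otherwise a coheir sequence gives too many classes
(`InvEquiv.r_of_sameType_over_model`). Conversely, conjugacy of ω-tuples under `Autf` is itself
bounded, and the orbit map at the class of `n` is injective on the group. This one map already makes
every ultra-closed set closed; that orbit maps respect limits gives the converse. Ultralimits yield
compactness, continuity of inversion and separate continuity of multiplication. Limits need not be
unique, so joint continuity needs one more fact: points outside the closure of 1 are separated from
1 (`gal_disjoint_nhds_one`, by compactness for formulas). Two limits of one ultrafilter are then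
topologically indistinguishable. The group is Hausdorff exactly when {1} is closed. Stabilizers of
bounded hyperimaginaries are closed, so faithfulness closes {1}. If {1} is closed, conjugacy under
`Autf` on the orbit of a finite subtuple of `n` is type-definable, and these finitary classes detect
every nontrivial element. For imaginaries, stabilizers are clopen; conversely a clopen subgroup is
cut out by one formula, whose traces define an imaginary with stabilizer inside the subgroup. -/

/-! ### Partial elementary maps, saturation and homogeneity -/

section ElementaryRelations

open FirstOrder.Language

variable {L : FirstOrder.Language.{u, v}} {M : Type w} [L.Structure M]

/-- The restriction of a formula to the finite set of its free variables. -/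
noncomputable def FirstOrder.Language.Formula.restrictVars {α : Type*} [DecidableEq α]
    (φ : L.Formula α) : L.Formula φ.freeVarFinset :=
  φ.restrictFreeVar id

theorem FirstOrder.Language.Formula.realize_restrictVars {α : Type*} [DecidableEq α]
    (φ : L.Formula α) (v : α → M) :
    φ.restrictVars.Realize (fun i => v i) ↔ φ.Realize v :=
  BoundedFormula.realize_restrictFreeVar v fun _ => rfl

/-- Dependent choice along a well-order. -/
theorem exists_wellOrdered_dependent_choice {J X : Type*} [LinearOrder J] [WellFoundedLT J]
    (Q : ∀ j : J, (Set.Iio j → X) → X → Prop) (h : ∀ j g, ∃ x, Q j g x) :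
    ∃ x : J → X, ∀ j, Q j (fun k => x k) (x j) := by
  choose F hF using h
  let x : J → X := (wellFounded_lt (α := J)).fix fun j r => F j fun k => r k.1 k.2
  refine ⟨x, fun j => ?_⟩
  have hx : x j = F j fun k => x k := (wellFounded_lt (α := J)).fix_eq _ j
  rw [hx]
  exact hF _ _

variable (L) in
/-- Two tuples, possibly in different structures, have the same complete type. -/
def SameType {M N : Type*} [L.Structure M] [L.Structure N] {ι : Type*} (a : ι → M) (b : ι → N) :
    Prop :=
  ∀ φ : L.Formula ι, φ.Realize a ↔ φ.Realize b

namespace SameType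

variable {N : Type*} [L.Structure N] {ι κ : Type*} {a : ι → M} {b : ι → N}

theorem refl (a : ι → M) : SameType L a a := fun _ => Iff.rfl

theorem symm (h : SameType L a b) : SameType L b a := fun φ => (h φ).symm

theorem comp (h : SameType L a b) (σ : κ → ι) : SameType L (a ∘ σ) (b ∘ σ) := fun φ => by
  rw [← Formula.realize_relabel, ← Formula.realize_relabel]
  exact h _

theorem of_imp (h : ∀ φ : L.Formula ι, φ.Realize a → φ.Realize b) : SameType L a b := fun φ =>
  ⟨h φ, fun hb => by
    by_contra hn
    exact (h φ.not (by simpa using hn)) hb⟩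

theorem aut (f : M ≃[L] M) (a : ι → M) : SameType L (f ∘ a) a := fun φ =>
  StrongHomClass.realize_formula f φ

end SameType

variable (L) in
/-- A relation between two structures is elementary if related tuples have the same type. -/
def ElemRel {N : Type*} [L.Structure N] (P : Set (N × M)) : Prop :=
  ∀ (n : ℕ) (φ : L.Formula (Fin n)) (v : Fin n → N × M), (∀ i, v i ∈ P) →
    (φ.Realize (Prod.fst ∘ v) ↔ φ.Realize (Prod.snd ∘ v))

namespace ElemRel

variable {N : Type*} [L.Structure N] {P : Set (N × M)}

theorem sameType (h : ElemRel L P) {α : Type*} (v : α → N × M) (hv : ∀ i, v i ∈ P) :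
    SameType L (Prod.fst ∘ v) (Prod.snd ∘ v) := fun φ => by
  classical
  have e := φ.freeVarFinset.equivFin
  have := h _ (φ.restrictVars.relabel e) (fun i => v (e.symm i)) fun i => hv _
  rw [Formula.realize_relabel, Formula.realize_relabel] at this
  rw [← Formula.realize_restrictVars, ← Formula.realize_restrictVars φ]
  convert this using 2 <;> funext i <;> simp

theorem of_finite (h : ∀ F ⊆ P, F.Finite → ElemRel L F) : ElemRel L P := fun n φ v hv =>
  h (Set.range v) (by rintro _ ⟨i, rfl⟩; exact hv i) (Set.finite_range v) n φ v
    fun i => Set.mem_range_self i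

theorem mono (h : ElemRel L P) {Q : Set (N × M)} (hQ : Q ⊆ P) : ElemRel L Q :=
  fun n φ v hv => h n φ v fun i => hQ (hv i)

theorem of_sameType {ι : Type*} {a : ι → N} {b : ι → M} (h : SameType L a b) :
    ElemRel L (Set.range fun k => (a k, b k)) := fun n φ v hv => by
  choose σ hσ using hv
  have := h.comp σ φ
  convert this using 2 <;> funext i <;> simp [← hσ]

theorem eq_iff (h : ElemRel L P) {p q : N × M} (hp : p ∈ P) (hq : q ∈ P) :
    p.1 = q.1 ↔ p.2 = q.2 := by
  have := h.sameType ![p, q] (by simp [Fin.forall_fin_two, hp, hq])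
    (Term.equal (Term.var 0) (Term.var 1))
  simpa [Formula.realize_equal] using this

theorem swap {P : Set (N × M)} (h : ElemRel L P) : ElemRel L (Prod.swap '' P) :=
  fun n φ v hv => by
    choose p hp hpv using hv
    have := h n φ p hp
    convert this.symm using 2 <;> funext i <;> simp [← hpv]

end ElemRel

/-- Saturation for formulas with parameters substituted for variables. -/
theorem IsSaturated.exists_realize (hsat : IsSaturated L M) {A : Set M} (hA : #A < #M)
    (p : Set (L.Formula (A ⊕ Unit)))
    (hp : ∀ q : Finset (L.Formula (A ⊕ Unit)), ↑q ⊆ p →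
      ∃ x : M, ∀ φ ∈ q, φ.Realize (Sum.elim (↑) fun _ => x)) :
    ∃ x : M, ∀ φ ∈ p, φ.Realize (Sum.elim (↑) fun _ => x) := by
  classical
  have key : ∀ (χ : L[[A]].Formula Unit) (x : M),
      (BoundedFormula.constantsVarsEquiv χ).Realize (Sum.elim ((↑) : A → M) fun _ => x) default ↔
        χ.Realize fun _ => x := by
    intro χ x
    exact BoundedFormula.realize_constantsVarsEquiv
  obtain ⟨x, hx⟩ := hsat A hA {χ | (BoundedFormula.constantsVarsEquiv χ : L.Formula _) ∈ p} (by
    intro q hq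
    obtain ⟨x, hx⟩ := hp (q.image fun χ => BoundedFormula.constantsVarsEquiv χ) (by
      intro φ hφ
      obtain ⟨χ, hχ, rfl⟩ := Finset.mem_image.1 (Finset.mem_coe.1 hφ)
      exact hq hχ)
    exact ⟨x, fun χ hχ => (key χ x).1 (hx _ (Finset.mem_image_of_mem _ hχ))⟩)
  refine ⟨x, fun φ hφ => ?_⟩
  have := hx (BoundedFormula.constantsVarsEquiv.symm φ) (by simpa using hφ)
  have h2 := (key _ x).2 this
  rwa [Equiv.apply_symm_apply] at h2

/-- The type of `x` over the first coordinates, rewritten over the second ones, is finitely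
satisfiable: existential formulas transfer along `P`. Saturation realizes it. Only the side in `M`
must be small, so `N` may be an ultrapower. -/
theorem ElemRel.exists_insert_fst {N : Type*} [L.Structure N] (hsat : IsSaturated L M)
    {P : Set (N × M)} (hP : ElemRel L P) (hc : #(Prod.snd '' P : Set M) < #M) (x : N) :
    ∃ y : M, ElemRel L (insert (x, y) P) := by
  classical
  set A : Set M := Prod.snd '' P with hA
  have hg : ∀ m : A, ∃ p ∈ P, p.2 = (m : M) := fun m => m.2
  choose g hgP hg using hg
  have hsnd : ((↑) : A → M) = Prod.snd ∘ g := funext fun m => (hg m).symm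
  obtain ⟨y, hy⟩ := hsat.exists_realize hc
    {φ | φ.Realize (Sum.elim (Prod.fst ∘ g) fun _ => x)} (by
      intro q hq
      let ψ : L.Formula A := (Formula.iInf fun φ : q => φ.1).iExs Unit
      have h1 : ψ.Realize (Prod.fst ∘ g) := by
        simp only [ψ, Formula.realize_iExs, Formula.realize_iInf]
        exact ⟨fun _ => x, fun φ => hq φ.2⟩
      rw [hP.sameType g hgP ψ, ← hsnd] at h1
      simp only [ψ, Formula.realize_iExs, Formula.realize_iInf] at h1
      obtain ⟨z, hz⟩ := h1
      exact ⟨z (), fun φ hφ => hz ⟨φ, hφ⟩⟩)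
  have hy' : SameType L (Sum.elim (Prod.fst ∘ g) fun _ : Unit => x)
      (Sum.elim ((↑) : A → M) fun _ => y) := .of_imp hy
  refine ⟨y, fun n φ v hv => ?_⟩
  let σ : Fin n → A ⊕ Unit := fun i =>
    if h : v i ∈ P then Sum.inl ⟨(v i).2, Set.mem_image_of_mem _ h⟩ else Sum.inr ()
  convert hy'.comp σ φ using 2
  · funext i
    by_cases h : v i ∈ P
    · simp only [Function.comp, σ, h, dif_pos, Sum.elim_inl]
      exact (hP.eq_iff h (hgP _)).2 (hg ⟨(v i).2, Set.mem_image_of_mem _ h⟩).symm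
    · have hσ : σ i = Sum.inr () := by simp only [σ, h, dif_neg, not_false_eq_true]
      rw [Function.comp_apply, Function.comp_apply, hσ, (hv i).resolve_right h]
      rfl
  · funext i
    by_cases h : v i ∈ P
    · simp [σ, h]
    · have hσ : σ i = Sum.inr () := by simp only [σ, h, dif_neg, not_false_eq_true]
      rw [Function.comp_apply, Function.comp_apply, hσ, (hv i).resolve_right h]
      rfl

/-- Transfinite extension of elementary relations, where the step `j` adds a pair with property
`R j`. -/
theorem ElemRel.exists_extension {N : Type*} [L.Structure N] {J : Type*} [LinearOrder J]
    [WellFoundedLT J] (hM : ℵ₀ ≤ #M) (hJ : ∀ j : J, lift.{w} #(Set.Iio j) < lift #M)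
    {P : Set (N × M)} (hP : ElemRel L P) (hc : #(Prod.snd '' P : Set M) < #M)
    (R : J → N × M → Prop)
    (hR : ∀ j (Q : Set (N × M)), ElemRel L Q → #(Prod.snd '' Q : Set M) < #M →
      ∃ p, R j p ∧ ElemRel L (insert p Q)) :
    ∃ x : J → N × M, (∀ j, R j (x j)) ∧ ElemRel L (P ∪ Set.range x) := by
  have hcard : ∀ (j : J) (g : Set.Iio j → N × M),
      #(Prod.snd '' (P ∪ Set.range g) : Set M) < #M := by
    intro j g
    rw [Set.image_union, ← Set.range_comp]
    refine (mk_union_le _ _).trans_lt (add_lt_of_lt hM hc ?_)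
    have := mk_range_le_lift (f := Prod.snd ∘ g)
    rw [← lift_lt]
    exact this.trans_lt (hJ j)
  -- The requirement is conditional on elementarity so far, which makes it satisfiable for arbitrary
  -- partial families; `hall` discharges the condition afterwards.
  obtain ⟨x, hx⟩ := exists_wellOrdered_dependent_choice
    (fun (j : J) (g : Set.Iio j → N × M) p => ElemRel L (P ∪ Set.range g) →
      R j p ∧ ElemRel L (insert p (P ∪ Set.range g))) (by
      intro j g
      by_cases h : ElemRel L (P ∪ Set.range g)
      · obtain ⟨p, hp⟩ := hR j _ h (hcard j g)
        exact ⟨p, fun _ => hp⟩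
      · obtain ⟨p, -⟩ := hR j P hP hc
        exact ⟨p, fun h' => (h h').elim⟩)
  -- Elementarity has finite character, and finitely many steps all occur by the stage of the
  -- largest one.
  have hfin : ∀ s : Set J, (∀ j ∈ s, ElemRel L (insert (x j)
      (P ∪ Set.range fun k : Set.Iio j => x k))) → ElemRel L (P ∪ x '' s) := by
    intro s hs
    refine ElemRel.of_finite fun F hF hfin => ?_
    have h1 : ∃ t ⊆ s, t.Finite ∧ F ⊆ P ∪ x '' t := by
      have : (F \ P) ⊆ x '' s := fun p hp => (hF hp.1).resolve_left hp.2
      obtain ⟨t, hts, ht, heq⟩ := Set.exists_subset_image_finite_and.1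
        ⟨F \ P, this, hfin.sdiff, rfl⟩
      refine ⟨t, hts, ht, fun p hp => ?_⟩
      by_cases hpP : p ∈ P
      · exact Or.inl hpP
      · exact Or.inr (heq ▸ ⟨hp, hpP⟩)
    obtain ⟨t, hts, ht, hFt⟩ := h1
    rcases t.eq_empty_or_nonempty with rfl | hne
    · exact hP.mono (by simpa using hFt)
    · obtain ⟨j, hj, hmax⟩ := ht.exists_maximalFor id t hne
      refine (hs j (hts hj)).mono (hFt.trans ?_)
      rintro p (hp | ⟨k, hk, rfl⟩)
      · exact Or.inr (Or.inl hp)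
      · rcases lt_or_ge k j with h | h
        · exact Or.inr (Or.inr ⟨⟨k, h⟩, rfl⟩)
        · have := hmax hk h
          exact Or.inl (congrArg x (le_antisymm this h))
  have hall : ∀ j : J, ElemRel L (P ∪ Set.range fun k : Set.Iio j => x k) := by
    intro j
    induction j using WellFoundedLT.induction with
    | ind j ih =>
      have := hfin (Set.Iio j) fun k hk => (hx k (ih k hk)).2
      rwa [Set.image_eq_range] at this
  refine ⟨x, fun j => (hx j (hall j)).1, ?_⟩
  have := hfin Set.univ fun k _ => (hx k (hall k)).2
  rwa [Set.image_univ] at this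

theorem ElemRel.exists_tuple {N : Type*} [L.Structure N] (hsat : IsSaturated L M) (hM : ℵ₀ ≤ #M)
    {P : Set (N × M)} (hP : ElemRel L P) (hc : #(Prod.snd '' P : Set M) < #M)
    {ι : Type*} [Countable ι] (x : ι → N) :
    ∃ c : ι → M, ElemRel L (P ∪ Set.range fun k => (x k, c k)) := by
  rcases isEmpty_or_nonempty ι with h | h
  · exact ⟨isEmptyElim, by simpa only [Set.range_eq_empty, Set.union_empty] using hP⟩
  obtain ⟨e, he⟩ := exists_surjective_nat ι
  obtain ⟨y, hy, hPy⟩ := hP.exists_extension (J := ℕ) hM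
    (fun j => (lift_lt_aleph0.2 (Set.finite_Iio j).lt_aleph0).trans_le (by simpa using hM)) hc
    (fun j p => p.1 = x (e j)) fun j Q hQ hcQ => by
      obtain ⟨z, hz⟩ := hQ.exists_insert_fst hsat hcQ (x (e j))
      exact ⟨_, rfl, hz⟩
  choose s hs using he
  refine ⟨fun k => (y (s k)).2, hPy.mono (Set.union_subset_union_right _ ?_)⟩
  rintro _ ⟨k, rfl⟩
  refine ⟨s k, Prod.ext ?_ rfl⟩
  rw [hy, hs]

/-- The class of a family in the ultrapower. -/
def ultraMk {I : Type*} (U : Ultrafilter I) (y : I → M) : (U : Filter I).Product fun _ : I => M :=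
  Quotient.mk _ y

theorem realize_ultrapower [Nonempty M] {I : Type*} (U : Ultrafilter I) {α : Type*}
    (φ : L.Formula α) (y : α → I → M) :
    (φ.Realize fun k => ultraMk U (y k)) ↔
      ∀ᶠ i in (U : Filter I), φ.Realize fun k => y k i :=
  Ultraproduct.realize_formula_cast (M := fun _ : I => M) φ y

/-- In a saturated model, limits of types of countable tuples over few parameters are realized. -/
theorem IsSaturated.exists_limit (hsat : IsSaturated L M) (hM : ℵ₀ ≤ #M) {I : Type*}
    (U : Ultrafilter I) {ι κ : Type*} [Countable ι] (x : I → ι → M) (b : κ → M)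
    (hb : #(Set.range b) < #M) :
    ∃ c : ι → M, ∀ φ : L.Formula (ι ⊕ κ),
      φ.Realize (Sum.elim c b) ↔ ∀ᶠ i in (U : Filter I), φ.Realize (Sum.elim (x i) b) := by
  have : Nonempty M := mk_ne_zero_iff.1 (aleph0_pos.trans_le hM).ne'
  -- By Łoś's theorem the limit type is the type of the class of `x` in the ultrapower over the
  -- diagonal. Extending the elementary relation between diagonal and parameters pulls it back into
  -- `M`.
  let d : (I → M) → (U : Filter I).Product fun _ : I => M := ultraMk U
  have h0 : ElemRel L (Set.range fun k => (d (fun _ => b k), b k)) := by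
    intro n φ v hv
    choose σ hσ using hv
    have := realize_ultrapower U φ
      fun k _ => b (σ k)
    rw [Filter.eventually_const] at this
    rw [show Prod.fst ∘ v = fun k => ultraMk U fun _ => b (σ k) from
        funext fun i => by simp [← hσ, d],
      show Prod.snd ∘ v = fun k => b (σ k) from funext fun i => by simp [← hσ] ]
    exact this
  obtain ⟨c, hc⟩ := h0.exists_tuple hsat hM (by rwa [← Set.range_comp])
    fun k : ι => d fun i => x i k
  refine ⟨c, fun φ => ?_⟩
  have h1 := hc.sameType
    (Sum.elim (fun k : ι => (d fun i => x i k, c k)) fun k : κ => (d fun _ => b k, b k)) (by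
      rintro (k | k)
      · exact Or.inr ⟨k, rfl⟩
      · exact Or.inl ⟨k, rfl⟩) φ
  have h2 := realize_ultrapower U φ
    (Sum.elim (fun k i => x i k) fun k _ => b k)
  have e1 : Prod.snd ∘ (Sum.elim (fun k : ι => (d fun i => x i k, c k))
      fun k : κ => (d fun _ => b k, b k)) = Sum.elim c b := by
    funext k; rcases k <;> rfl
  have e2 : Prod.fst ∘ (Sum.elim (fun k : ι => (d fun i => x i k, c k))
      fun k : κ => (d fun _ => b k, b k)) =
        fun k => d ((Sum.elim (fun k i => x i k) fun k _ => b k : ι ⊕ κ → I → M) k) := by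
    funext k; rcases k <;> rfl
  rw [e1, e2, h2] at h1
  rw [← h1]
  refine Filter.eventually_congr (Filter.Eventually.of_forall fun i => ?_)
  rw [show (fun k => (Sum.elim (fun k i => x i k) fun k _ => b k : ι ⊕ κ → I → M) k i) =
    Sum.elim (x i) b from by funext k; rcases k <;> rfl]

/-- An elementary relation that is total on both sides is an automorphism. -/
theorem ElemRel.exists_aut {P : Set (M × M)} (hP : ElemRel L P) (h1 : ∀ x, ∃ y, (x, y) ∈ P)
    (h2 : ∀ y, ∃ x, (x, y) ∈ P) : ∃ f : M ≃[L] M, ∀ x, (x, f x) ∈ P := by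
  choose f hf using h1
  choose g hg using h2
  refine ⟨⟨⟨f, g, fun x => (hP.eq_iff (hg _) (hf x)).2 rfl,
    fun y => (hP.eq_iff (hf _) (hg y)).1 rfl⟩, ?_, ?_⟩, hf⟩
  · intro n F x
    have := hP.sameType (Fin.cons (Structure.funMap F x, f (Structure.funMap F x))
      fun i => (x i, f (x i))) (by
        intro i
        refine Fin.cases ?_ (fun i => ?_) i
        · exact hf _
        · exact hf _) (Formula.graph F)
    rw [show Prod.fst ∘ (Fin.cons (Structure.funMap F x, f (Structure.funMap F x))
      fun i => (x i, f (x i)) : Fin (n + 1) → M × M) = Fin.cons (Structure.funMap F x) x from by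
        funext i; refine Fin.cases ?_ (fun i => ?_) i <;> rfl,
      show Prod.snd ∘ (Fin.cons (Structure.funMap F x, f (Structure.funMap F x))
      fun i => (x i, f (x i)) : Fin (n + 1) → M × M) =
        Fin.cons (f (Structure.funMap F x)) (f ∘ x) from by
        funext i; refine Fin.cases ?_ (fun i => ?_) i <;> rfl,
      Formula.realize_graph, Formula.realize_graph] at this
    exact (this.1 rfl).symm
  · intro n R x
    have := hP.sameType (fun i => (x i, f (x i))) (fun i => hf _) (R.formula Term.var)
    rw [Formula.realize_rel, Formula.realize_rel] at this
    exact this.symm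

/-- Saturated models are strongly homogeneous. -/
theorem IsSaturated.exists_aut (hsat : IsSaturated L M) (hM : ℵ₀ < #M) {ι : Type*} [Countable ι]
    {a b : ι → M} (h : SameType L a b) : ∃ f : M ≃[L] M, f ∘ a = b := by
  let J := (#M).ord.ToType
  -- Back and forth in one enumeration: the left copy of `M` schedules elements for the domain, the
  -- right copy for the range.
  have hJM : #J = #(M ⊕ M) := by
    rw [mk_ord_toType, mk_sum, lift_id, add_eq_self hM.le]
  obtain ⟨e⟩ := Cardinal.eq.1 hJM
  have hsmall : #(Prod.snd '' (Set.range fun k => (a k, b k)) : Set M) < #M := by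
    rw [← Set.range_comp]
    exact (Set.countable_range _).le_aleph0.trans_lt hM
  obtain ⟨x, hx, hP⟩ := (ElemRel.of_sameType h).exists_extension (J := J) hM.le
    (fun j => by
      have := mk_Iio_lt j (by simp [J])
      simpa [J] using this) hsmall
    (fun j p => Sum.elim (fun m => p.1 = m) (fun m => p.2 = m) (e j)) fun j Q hQ hcQ => by
      rcases hej : e j with m | m
      · obtain ⟨y, hy⟩ := hQ.exists_insert_fst hsat hcQ m
        exact ⟨(m, y), rfl, hy⟩
      · have hs := hQ.swap
        have hc : #(Prod.snd '' (Prod.swap '' Q) : Set M) < #M := by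
          -- Elementary relations preserve equality, so the domain is no larger than the range.
          refine lt_of_le_of_lt ?_ hcQ
          choose! g hg using fun (m : M) (hm : m ∈ Prod.snd '' (Prod.swap '' Q)) =>
            show ∃ y, (m, y) ∈ Q by
              obtain ⟨_, ⟨p, hp, rfl⟩, rfl⟩ := hm
              exact ⟨p.2, hp⟩
          refine mk_le_of_injective (f := fun m : (Prod.snd '' (Prod.swap '' Q) : Set M) =>
            (⟨g m, (m.1, g m), hg m m.2, rfl⟩ : (Prod.snd '' Q : Set M))) ?_
          intro m m' hmm
          exact Subtype.ext ((hQ.eq_iff (hg m m.2) (hg m' m'.2)).2 (congrArg Subtype.val hmm))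
        obtain ⟨y, hy⟩ := hs.exists_insert_fst hsat hc m
        refine ⟨(y, m), rfl, ?_⟩
        have := hy.swap
        rw [Set.image_insert_eq, ← Set.image_comp] at this
        simpa using this
  obtain ⟨f, hf⟩ := hP.exists_aut
    (fun m => by
      refine ⟨(x (e.symm (Sum.inl m))).2, Or.inr ⟨e.symm (Sum.inl m), Prod.ext ?_ rfl⟩⟩
      have := hx (e.symm (Sum.inl m))
      simpa using this)
    (fun m => by
      refine ⟨(x (e.symm (Sum.inr m))).1, Or.inr ⟨e.symm (Sum.inr m), Prod.ext rfl ?_⟩⟩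
      have := hx (e.symm (Sum.inr m))
      simpa using this)
  exact ⟨f, funext fun k => (hP.eq_iff (hf (a k)) (Or.inl ⟨k, rfl⟩)).1 rfl⟩

end ElementaryRelations

/-! ### Countable models, coheirs and bounded classes -/

section Models

open FirstOrder.Language

variable {L : FirstOrder.Language.{u, v}} {M : Type w} [L.Structure M]

/-- The form in which compactness is used below: conditions closed under conjunction and
individually satisfiable hold together along an ultrafilter. -/
theorem exists_ultrafilter_of_directed {X B : Type*} (P : B → Prop) (S : B → Set X)
    (hne : ∃ b, P b) (hdir : ∀ b c, P b → P c → ∃ d, P d ∧ S d ⊆ S b ∩ S c)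
    (hS : ∀ b, P b → (S b).Nonempty) : ∃ U : Ultrafilter X, ∀ b, P b → S b ∈ U := by
  obtain ⟨b₀, hb₀⟩ := hne
  have : Nonempty {b // P b} := ⟨⟨b₀, hb₀⟩⟩
  have hne : (⨅ b : {b // P b}, Filter.principal (S b)).NeBot := by
    refine Filter.iInf_neBot_of_directed' ?_ fun b => Filter.principal_neBot_iff.2 (hS b b.2)
    intro b c
    obtain ⟨d, hd, hsub⟩ := hdir b c b.2 c.2
    exact ⟨⟨d, hd⟩, Filter.principal_mono.2 (hsub.trans Set.inter_subset_left),
      Filter.principal_mono.2 (hsub.trans Set.inter_subset_right)⟩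
  refine ⟨Ultrafilter.of (⨅ b : {b // P b}, Filter.principal (S b)), fun b hb => ?_⟩
  exact Ultrafilter.of_le (⨅ b : {b // P b}, Filter.principal (S b))
    (Filter.mem_iInf_of_mem ⟨b, hb⟩ (Filter.mem_principal_self _))

/-- A formula with parameters in an elementary substructure that is satisfiable is satisfied by
a tuple of the substructure, even in infinitely many variables. -/
theorem exists_realize_of_elementaryEmbedding {K : Type*} [L.Structure K] [Nonempty K]
    (e : K ↪ₑ[L] M) {ι κ : Type*} (φ : L.Formula (ι ⊕ κ)) (b : κ → K)
    (a : ι → M) (ha : φ.Realize (Sum.elim a (e ∘ b))) :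
    ∃ σ : ι → K, φ.Realize (Sum.elim (e ∘ σ) (e ∘ b)) := by
  classical
  let s := φ.freeVarFinset
  let F := {i : ι // Sum.inl i ∈ s}
  have : Finite F := Finite.of_injective (fun i : F => (⟨Sum.inl i.1, i.2⟩ : s)) fun i j h => by
    exact Subtype.ext (Sum.inl_injective (congrArg Subtype.val h))
  let g : s → κ ⊕ F := fun k => match k with
    | ⟨Sum.inl i, hi⟩ => Sum.inr ⟨i, hi⟩
    | ⟨Sum.inr k, _⟩ => Sum.inl k
  let χ : L.Formula κ := (φ.restrictVars.relabel g).iExs F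
  have h1 : χ.Realize (e ∘ b) := by
    simp only [χ, Formula.realize_iExs]
    refine ⟨fun i => a i.1, ?_⟩
    rw [Formula.realize_relabel]
    rw [← Formula.realize_restrictVars] at ha
    convert ha using 1
    funext ⟨k, hk⟩
    rcases k with k | k <;> rfl
  rw [e.map_formula] at h1
  simp only [χ, Formula.realize_iExs] at h1
  obtain ⟨x, hx⟩ := h1
  -- Variables not occurring in the formula get an arbitrary value.
  let σ : ι → K := fun i => if h : Sum.inl i ∈ s then x ⟨i, h⟩ else Classical.arbitrary K
  refine ⟨σ, ?_⟩
  rw [← Sum.comp_elim, e.map_formula, ← Formula.realize_restrictVars]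
  rw [Formula.realize_relabel] at hx
  convert hx using 1
  funext ⟨k, hk⟩
  rcases k with k | k
  · have : σ k = x ⟨k, hk⟩ := dif_pos hk
    simpa [g] using this
  · rfl

/-- A coheir: an ultrafilter that extends the type of `a` over an elementary substructure and is
concentrated on the tuples of this substructure. -/
theorem exists_coheir {K : Type*} [L.Structure K] [Nonempty K] (e : K ↪ₑ[L] M) {ι : Type*}
    (a : ι → M) : ∃ U : Ultrafilter (ι → M),
      (∀ φ : L.Formula (ι ⊕ K), (∀ᶠ x in (U : Filter (ι → M)), φ.Realize (Sum.elim x e)) ↔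
        φ.Realize (Sum.elim a e)) ∧
      ∀ᶠ x in (U : Filter (ι → M)), ∃ σ : ι → K, x = e ∘ σ := by
  obtain ⟨U, hU⟩ := exists_ultrafilter_of_directed
    (fun φ : L.Formula (ι ⊕ K) => φ.Realize (Sum.elim a e))
    (fun φ => {x | (∃ σ : ι → K, x = e ∘ σ) ∧ φ.Realize (Sum.elim x e)})
    ⟨⊤, by simp⟩
    (fun φ ψ hφ hψ => ⟨φ ⊓ ψ, by simp [hφ, hψ], by
      rintro x ⟨hx, h⟩
      rw [Formula.realize_inf] at h
      exact ⟨⟨hx, h.1⟩, hx, h.2⟩⟩)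
    (fun φ hφ => by
      obtain ⟨σ, hσ⟩ := exists_realize_of_elementaryEmbedding e φ id a hφ
      exact ⟨e ∘ σ, ⟨σ, rfl⟩, hσ⟩)
  have h1 : ∀ φ : L.Formula (ι ⊕ K), φ.Realize (Sum.elim a e) →
      ∀ᶠ x in (U : Filter (ι → M)), φ.Realize (Sum.elim x e) := fun φ hφ =>
    Filter.mem_of_superset (hU φ hφ) fun x hx => hx.2
  refine ⟨U, fun φ => ⟨fun h => ?_, h1 φ⟩, Filter.mem_of_superset (hU ⊤ (by simp)) fun x hx => hx.1⟩
  by_contra hn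
  have := h1 φ.not (by simpa using hn)
  obtain ⟨x, hx, hx'⟩ := (h.and this).exists
  exact hx' hx

/-- For a tuple from `K` the truth value of `φ` depends on the parameters only through their type
over `K`, and `U` concentrates on such tuples. -/
theorem coheir_invariant {K : Type*} [L.Structure K] {e : K → M} {ι : Type*}
    {U : Ultrafilter (ι → M)} (hU : ∀ᶠ x in (U : Filter (ι → M)), ∃ σ : ι → K, x = e ∘ σ)
    {κ : Type*} {m m' : κ → M} (h : SameType L (Sum.elim m e) (Sum.elim m' e))
    (φ : L.Formula (ι ⊕ κ)) :
    (∀ᶠ x in (U : Filter (ι → M)), φ.Realize (Sum.elim x m)) ↔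
      ∀ᶠ x in (U : Filter (ι → M)), φ.Realize (Sum.elim x m') := by
  refine Filter.eventually_congr (hU.mono ?_)
  rintro _ ⟨σ, rfl⟩
  have := h.comp (Sum.elim (fun i => Sum.inr (σ i)) Sum.inl) φ
  convert this using 2 <;> (funext k; rcases k with k | k <;> rfl)

theorem InvEquiv.r_iff_of_sameType (hsat : IsSaturated L M) (hM : ℵ₀ < #M) {ι : Type} [Countable ι]
    (E : InvEquiv L M ι) {a b a' b' : ι → M} (h : SameType L (Sum.elim a b) (Sum.elim a' b')) :
    E.r a b ↔ E.r a' b' := by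
  obtain ⟨f, hf⟩ := hsat.exists_aut hM h
  have ha : f ∘ a = a' := funext fun i => congrFun hf (Sum.inl i)
  have hb : f ∘ b = b' := funext fun i => congrFun hf (Sum.inr i)
  constructor
  · intro h
    rw [← ha, ← hb]
    exact E.invariant f a b h
  · intro h
    have := E.invariant f⁻¹ a' b' h
    have h1 : ∀ x, f⁻¹ (f x) = x := aut_inv_apply_self f
    rw [← ha, ← hb] at this
    simpa [Function.comp_def, h1] using this

theorem InvEquiv.smul_cls {ι : Type} (E : InvEquiv L M ι) (f : M ≃[L] M) (a : ι → M) :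
    f • E.cls a = E.cls (f ∘ a) := rfl

theorem InvEquiv.cls_eq_iff {ι : Type} (E : InvEquiv L M ι) {a b : ι → M} :
    E.cls a = E.cls b ↔ E.r a b := Quotient.eq

/-- Tuples with the same type over a countable elementary substructure are equivalent modulo each
invariant equivalence relation for which the class is bounded. -/
theorem InvEquiv.r_of_sameType_over_model (hsat : IsSaturated L M) (hM : 𝔠 < #M) {K : Type w}
    [L.Structure K] [Nonempty K] [Countable K] (e : K ↪ₑ[L] M) {ι : Type} [Countable ι]
    (E : InvEquiv L M ι) {a b : ι → M} (hab : SameType L (Sum.elim a e) (Sum.elim b e))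
    (ha : InvEquiv.IsBoundedElt (E.cls a)) : E.r a b := by
  have hM0 : ℵ₀ < #M := aleph0_lt_continuum.trans hM
  obtain ⟨U, hUa, hUK⟩ := exists_coheir e a
  -- The coheir sequence has length 𝔠⁺, one more than a bounded orbit can hold, while each stage has
  -- at most 𝔠 < #M parameters.
  let J : Type w := (Order.succ (𝔠 : Cardinal.{w})).ord.ToType
  have hJ : #J = Order.succ (𝔠 : Cardinal.{w}) := mk_ord_toType _
  have hJlt : ∀ j : J, #(Set.Iio j) ≤ 𝔠 := by
    intro j
    have := mk_Iio_lt j (by simp [J])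
    rw [hJ] at this
    exact Order.lt_succ_iff.1 this
  obtain ⟨c, hc⟩ := exists_wellOrdered_dependent_choice
    (fun (j : J) (g : Set.Iio j → ι → M) (x : ι → M) =>
      ∀ φ : L.Formula (ι ⊕ ((Set.Iio j × ι) ⊕ K)),
        φ.Realize (Sum.elim x (Sum.elim (fun p => g p.1 p.2) e)) ↔
          ∀ᶠ y in (U : Filter (ι → M)), φ.Realize (Sum.elim y (Sum.elim (fun p => g p.1 p.2) e)))
    fun j g => hsat.exists_limit hM0.le U (fun y => y) _ (by
      refine lt_of_le_of_lt ?_ hM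
      rw [Set.Sum.elim_range]
      refine (mk_union_le _ _).trans ?_
      refine (add_le_add mk_range_le mk_range_le).trans (add_le_of_le aleph0_le_continuum ?_ ?_)
      · rw [mk_prod, lift_id']
        refine (mul_le_mul' (hJlt j) (lift_le_aleph0.2 (mk_le_aleph0 (α := ι)))).trans ?_
        rw [continuum_mul_aleph0]
      · exact mk_le_aleph0.trans aleph0_le_continuum)
  have hca : ∀ j, SameType L (Sum.elim (c j) e) (Sum.elim a e) := by
    intro j φ
    rw [← hUa]
    have := hc j (φ.relabel (Sum.map id Sum.inr))
    simpa only [Formula.realize_relabel, Sum.elim_comp_map, Sum.elim_comp_inr, Function.comp_id]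
      using this
  -- By invariance (d, a), (d, b) and all pairs (c j, c k) with k < j have the same type. If `d` is
  -- equivalent to `a`, then also to `b`; if not, the `c j` are pairwise inequivalent.
  obtain ⟨d, hd⟩ := hsat.exists_limit hM0.le U (fun y => y) (Sum.elim a b) (by
    exact (Set.countable_range _).le_aleph0.trans_lt hM0)
  have hda : ∀ φ : L.Formula (ι ⊕ ι), φ.Realize (Sum.elim d a) ↔
      ∀ᶠ y in (U : Filter (ι → M)), φ.Realize (Sum.elim y a) := by
    intro φ
    have := hd (φ.relabel (Sum.map id Sum.inl))
    simpa only [Formula.realize_relabel, Sum.elim_comp_map, Sum.elim_comp_inl, Function.comp_id]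
      using this
  have hdb : ∀ φ : L.Formula (ι ⊕ ι), φ.Realize (Sum.elim d b) ↔
      ∀ᶠ y in (U : Filter (ι → M)), φ.Realize (Sum.elim y b) := by
    intro φ
    have := hd (φ.relabel (Sum.map id Sum.inr))
    simpa only [Formula.realize_relabel, Sum.elim_comp_map, Sum.elim_comp_inr, Function.comp_id]
      using this
  have hcc : ∀ j k, k < j → SameType L (Sum.elim (c j) (c k)) (Sum.elim d a) := by
    intro j k hk φ
    rw [hda, ← coheir_invariant hUK (hca k)]
    have := hc j (φ.relabel (Sum.map id fun i => Sum.inl (⟨k, hk⟩, i)))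
    simp only [Formula.realize_relabel, Sum.elim_comp_map, Function.comp_id] at this
    exact this
  by_cases hE : E.r d a
  · have h2 : SameType L (Sum.elim d a) (Sum.elim d b) := fun φ => by
      rw [hda, hdb, coheir_invariant hUK hab]
    exact E.iseqv.trans (E.iseqv.symm hE) ((E.r_iff_of_sameType hsat hM0 h2).1 hE)
  · exfalso
    have hmem : ∀ j, E.cls (c j) ∈ MulAction.orbit (M ≃[L] M) (E.cls a) := by
      intro j
      have h1 : SameType L a (c j) := by
        have := (hca j).symm.comp (Sum.inl : ι → ι ⊕ K)
        simpa using this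
      obtain ⟨f, hf⟩ := hsat.exists_aut hM0 h1
      exact ⟨f, by rw [← hf]; rfl⟩
    have hne : ∀ j k, k < j → E.cls (c j) ≠ E.cls (c k) := by
      intro j k hk h
      exact hE ((E.r_iff_of_sameType hsat hM0 (hcc j k hk)).1 (E.cls_eq_iff.1 h))
    have hinj : Function.Injective fun j : J =>
        (⟨E.cls (c j), hmem j⟩ : MulAction.orbit (M ≃[L] M) (E.cls a)) := by
      intro j k h
      have h := congrArg Subtype.val h
      rcases lt_trichotomy j k with hjk | hjk | hjk
      · exact (hne k j hjk h.symm).elim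
      · exact hjk
      · exact (hne j k hjk h).elim
    have := (mk_le_of_injective hinj).trans ha
    rw [hJ] at this
    exact (Order.lt_succ (𝔠 : Cardinal.{w})).not_ge this

variable (L) in
/-- The tuple enumerates an elementary substructure. -/
def IsModelTuple (n : ℕ → M) : Prop :=
  ∃ N : L.ElementarySubstructure M, (N : Set M) = Set.range n

/-- Downward Löwenheim–Skolem lets every generator of `Autf` fix a countable model. The countable
case is separate because `N` may be finite as far as the hypotheses go. -/
theorem exists_countable_elementaryEmbedding [Countable L.Symbols]
    (N : L.ElementarySubstructure M) : ∃ (K : Type w) (_ : L.Structure K) (_ : Countable K)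
      (e : K ↪ₑ[L] M), ∀ x, e x ∈ N := by
  by_cases hN : Countable N
  · exact ⟨N, _, hN, N.subtype, fun x => x.2⟩
  · have h0 : ℵ₀ ≤ #N := by
      by_contra h
      exact hN (mk_le_aleph0_iff.1 (not_le.1 h).le)
    obtain ⟨S, -, hS⟩ := exists_elementarySubstructure_card_eq L (∅ : Set N)
      (ℵ₀ : Cardinal.{w}) le_rfl
      (by simp) (by
        have : L.card ≤ ℵ₀ := mk_le_aleph0_iff.2 inferInstance
        simpa using this) (by simpa using h0)
    refine ⟨S, inferInstance, ?_, N.subtype.comp S.subtype, fun x => x.1.2⟩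
    rw [← mk_le_aleph0_iff]
    simpa using hS.le

theorem exists_isModelTuple [Countable L.Symbols] (hM : ℵ₀ ≤ #M) {ι : Type*} [Countable ι]
    (a : ι → M) : ∃ n : ℕ → M, IsModelTuple L n ∧ ∃ σ : ι → ℕ, a = n ∘ σ := by
  obtain ⟨S, haS, hS⟩ := exists_elementarySubstructure_card_eq L (Set.range a)
    (ℵ₀ : Cardinal.{w}) le_rfl
    (by simpa using (Set.countable_range a).le_aleph0) (by
      have : L.card ≤ ℵ₀ := mk_le_aleph0_iff.2 inferInstance
      simpa using this) (by simpa using hM)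
  have hSc : Countable S := by
    rw [← mk_le_aleph0_iff]
    simpa using hS.le
  have hne : Nonempty S := by
    rw [← mk_ne_zero_iff]
    intro h
    rw [h] at hS
    simp [aleph0_ne_zero.symm] at hS
  obtain ⟨g, hg⟩ := exists_surjective_nat S
  choose σ hσ using fun i => hg ⟨a i, haS ⟨i, rfl⟩⟩
  refine ⟨fun k => g k, ⟨S, ?_⟩, σ, funext fun i => by simp [hσ]⟩
  ext x
  constructor
  · intro hx
    obtain ⟨k, hk⟩ := hg ⟨x, hx⟩
    exact ⟨k, congrArg Subtype.val hk⟩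
  · rintro ⟨k, rfl⟩
    exact (g k).2

theorem mem_autf_of_fix {n : ℕ → M} (hn : IsModelTuple L n) {f : M ≃[L] M} (hf : f ∘ n = n) :
    f ∈ Autf L M := by
  obtain ⟨N, hN⟩ := hn
  refine Subgroup.subset_closure ⟨N, fun x hx => ?_⟩
  have hx : x ∈ (N : Set M) := hx
  rw [hN] at hx
  obtain ⟨k, rfl⟩ := hx
  exact congrFun hf k

theorem nonempty_of_continuum_lt (hM : 𝔠 < #M) : Nonempty M :=
  mk_ne_zero_iff.1 (continuum_pos.trans hM).ne'

/-- Strong automorphisms fix bounded ultra-imaginary elements. -/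
theorem smul_eq_of_mem_autf [Countable L.Symbols] (hsat : IsSaturated L M) (hM : 𝔠 < #M)
    {ι : Type} [Countable ι] {E : InvEquiv L M ι} {α : E.Classes} (hα : InvEquiv.IsBoundedElt α)
    {f : M ≃[L] M} (hf : f ∈ Autf L M) : f • α = α := by
  have hsub : Autf L M ≤ MulAction.stabilizer (M ≃[L] M) α := by
    refine (Subgroup.closure_le _).2 ?_
    rintro f ⟨N, hN⟩
    obtain ⟨K, _, _, e, he⟩ := exists_countable_elementaryEmbedding N
    have := nonempty_of_continuum_lt hM
    have hK : Nonempty K := by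
      have h := e.map_sentence ((⊤ : L.Formula (Empty ⊕ Unit)).iExs Unit)
      simp only [Sentence.Realize, Formula.realize_iExs] at h
      obtain ⟨g, -⟩ := h.2 ⟨fun _ => Classical.arbitrary M, by simp⟩
      exact ⟨g ()⟩
    induction α using Quotient.inductionOn with
    | h a =>
      change f • E.cls a = E.cls a
      rw [InvEquiv.smul_cls, eq_comm, InvEquiv.cls_eq_iff]
      refine E.r_of_sameType_over_model hsat hM e ?_ hα
      have hfe : f ∘ e = e := funext fun x => hN _ (he x)
      have := (SameType.aut f (Sum.elim a e)).symm
      rwa [Sum.comp_elim, hfe] at this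
  exact hsub hf

end Models

/-! ### Limits of automorphisms along ultrafilters -/

section Limits

open FirstOrder.Language

variable {L : FirstOrder.Language.{u, v}} {M : Type w} [L.Structure M]

variable (L) in
/-- The type of `c` is the limit of the types of the tuples `x i` along the ultrafilter `U`. -/
def TypeLim {I ι : Type*} (U : Ultrafilter I) (x : I → ι → M) (c : ι → M) : Prop :=
  ∀ φ : L.Formula ι, φ.Realize c ↔ ∀ᶠ i in (U : Filter I), φ.Realize (x i)

namespace TypeLim

variable {I ι κ : Type*} {U : Ultrafilter I} {x y : I → ι → M} {c d : ι → M}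

theorem comp (h : TypeLim L U x c) (σ : κ → ι) : TypeLim L U (fun i => x i ∘ σ) (c ∘ σ) := by
  intro φ
  have := h (φ.relabel σ)
  simpa only [Formula.realize_relabel] using this

theorem sameType (h : TypeLim L U x c) (h' : TypeLim L U x d) : SameType L c d :=
  fun φ => (h φ).trans (h' φ).symm

theorem of_sameType (h : TypeLim L U x c) (h' : SameType L c d) : TypeLim L U x d :=
  fun φ => (h' φ).symm.trans (h φ)

theorem congr (h : TypeLim L U x c) (h' : ∀ᶠ i in (U : Filter I), SameType L (x i) (y i)) :
    TypeLim L U y c := fun φ =>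
  (h φ).trans (Filter.eventually_congr (h'.mono fun _ hi => hi φ))

theorem const (c : ι → M) : TypeLim L U (fun _ => c) c := fun φ => by simp

theorem of_forall_sameType (h : ∀ i, SameType L (x i) c) : TypeLim L U x c :=
  (const c).congr (Filter.Eventually.of_forall fun i => (h i).symm)

theorem realize_of_eventually (h : TypeLim L U x c) {φ : L.Formula ι}
    (hφ : ∀ᶠ i in (U : Filter I), φ.Realize (x i)) : φ.Realize c := (h φ).2 hφ

end TypeLim

theorem IsSaturated.exists_typeLim (hsat : IsSaturated L M) (hM : 𝔠 < #M) {I : Type*}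
    (U : Ultrafilter I) {ι κ : Type*} [Countable ι] [Countable κ] (x : I → ι → M) (b : κ → M) :
    ∃ c : ι → M, TypeLim L U (fun i => Sum.elim (x i) b) (Sum.elim c b) :=
  hsat.exists_limit (aleph0_lt_continuum.trans hM).le U x b
    ((Set.countable_range _).le_aleph0.trans_lt (aleph0_lt_continuum.trans hM))

/-- `g` is a limit of the automorphisms `f i`, as far as the type of the image of `n` over `n` is
concerned. -/
def LimAt {I : Type*} (U : Ultrafilter I) (n : ℕ → M) (f : I → (M ≃[L] M)) (g : M ≃[L] M) : Prop :=
  TypeLim L U (fun i => Sum.elim (f i ∘ n) n) (Sum.elim (g ∘ n) n)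

theorem Gal.mk_mul (f g : M ≃[L] M) : Gal.mk (f * g) = Gal.mk f * Gal.mk g := rfl

theorem Gal.mk_inv (f : M ≃[L] M) : Gal.mk f⁻¹ = (Gal.mk f)⁻¹ := rfl

theorem Gal.mk_one : Gal.mk (1 : M ≃[L] M) = 1 := rfl

theorem Gal.mk_eq_one_iff {f : M ≃[L] M} : Gal.mk f = 1 ↔ f ∈ Autf L M :=
  QuotientGroup.eq_one_iff f

theorem Gal.mk_surjective : Function.Surjective (Gal.mk (L := L) (M := M)) :=
  QuotientGroup.mk_surjective

theorem Gal.mk_out (γ : Gal L M) : Gal.mk (Quotient.out γ : M ≃[L] M) = γ := Quotient.out_eq γ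

theorem Gal.mk_eq_mk_iff {f g : M ≃[L] M} : Gal.mk f = Gal.mk g ↔ g⁻¹ * f ∈ Autf L M := by
  rw [← Gal.mk_eq_one_iff, Gal.mk_mul, Gal.mk_inv, inv_mul_eq_one, eq_comm]

theorem Gal.mk_eq_mk_of_comp_eq {n : ℕ → M} (hn : IsModelTuple L n) {f g h : M ≃[L] M}
    (hh : h ∈ Autf L M) (hfg : h ∘ f ∘ n = g ∘ n) : Gal.mk f = Gal.mk g := by
  have h1 : g⁻¹ * h * f ∈ Autf L M := by
    refine mem_autf_of_fix hn (funext fun k => ?_)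
    change g⁻¹ (h (f (n k))) = n k
    rw [show h (f (n k)) = g (n k) from congrFun hfg k, aut_inv_apply_self]
  rw [← Gal.mk_eq_one_iff, Gal.mk_mul, Gal.mk_mul, Gal.mk_eq_one_iff.2 hh, mul_one, Gal.mk_inv,
    inv_mul_eq_one] at h1
  exact h1.symm

theorem InvEquiv.IsBounded.isBoundedElt {ι : Type} {E : InvEquiv L M ι} (hE : E.IsBounded)
    (α : E.Classes) : InvEquiv.IsBoundedElt α := (mk_subtype_le _).trans hE

/-- Equivalence of tuples under strong automorphisms. -/
def lascarEquiv (L : FirstOrder.Language.{u, v}) (M : Type w) [L.Structure M] (ι : Type) :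
    InvEquiv L M ι where
  r a b := ∃ h ∈ Autf L M, h ∘ a = b
  iseqv := by
    refine ⟨fun a => ⟨1, one_mem _, rfl⟩, ?_, ?_⟩
    · rintro a _ ⟨h, hh, rfl⟩
      exact ⟨h⁻¹, inv_mem hh, funext fun k => aut_inv_apply_self h (a k)⟩
    · rintro a _ _ ⟨h, hh, rfl⟩ ⟨h', hh', rfl⟩
      exact ⟨h' * h, mul_mem hh' hh, rfl⟩
  invariant := by
    rintro f a _ ⟨h, hh, rfl⟩
    refine ⟨f * h * f⁻¹, autf_normal.conj_mem h hh f, funext fun k => ?_⟩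
    exact congrArg (fun y => f (h y)) (aut_inv_apply_self f (a k))

theorem IsSaturated.exists_aut_of_continuum_lt (hsat : IsSaturated L M) (hM : 𝔠 < #M)
    {ι : Type*} [Countable ι] {a b : ι → M} (h : SameType L a b) : ∃ f : M ≃[L] M, f ∘ a = b :=
  hsat.exists_aut (aleph0_lt_continuum.trans hM) h

/-- Homogeneity gives an automorphism fixing `n`, hence strong, that moves `f ∘ n` to `g ∘ n`. -/
theorem Gal.mk_eq_mk_of_sameType (hsat : IsSaturated L M) (hM : 𝔠 < #M) {n : ℕ → M}
    (hn : IsModelTuple L n) {f g : M ≃[L] M}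
    (h : SameType L (Sum.elim (f ∘ n) n) (Sum.elim (g ∘ n) n)) : Gal.mk f = Gal.mk g := by
  obtain ⟨k, hk⟩ := hsat.exists_aut_of_continuum_lt hM h
  rw [Sum.comp_elim, Sum.elim_eq_iff] at hk
  exact Gal.mk_eq_mk_of_comp_eq hn (mem_autf_of_fix hn hk.2) hk.1

theorem smul_eq_smul_of_mk_eq [Countable L.Symbols] (hsat : IsSaturated L M) (hM : 𝔠 < #M)
    {ι : Type} [Countable ι] {E : InvEquiv L M ι} {α : E.Classes} (hα : InvEquiv.IsBoundedElt α)
    {f g : M ≃[L] M} (h : Gal.mk f = Gal.mk g) : f • α = g • α := by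
  have := smul_eq_of_mem_autf hsat hM hα (Gal.mk_eq_mk_iff.1 h)
  rwa [mul_smul, inv_smul_eq_iff] at this

theorem galAct_mk [Countable L.Symbols] (hsat : IsSaturated L M) (hM : 𝔠 < #M)
    {ι : Type} [Countable ι] {E : InvEquiv L M ι} {α : E.Classes} (hα : InvEquiv.IsBoundedElt α)
    (f : M ≃[L] M) : galAct (Gal.mk f) α = f • α :=
  smul_eq_smul_of_mk_eq hsat hM hα (Gal.mk_out _)

/-- A class is determined by the type of a member over a countable model, and there are at most 2^ℵ₀
sets of formulas in countably many variables. -/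
theorem lascarEquiv_isBounded [Countable L.Symbols] (hsat : IsSaturated L M) (hM : 𝔠 < #M)
    (ι : Type) [Countable ι] : (lascarEquiv L M ι).IsBounded := by
  obtain ⟨n, hn, -⟩ := exists_isModelTuple (L := L) (aleph0_lt_continuum.trans hM).le
    (Empty.elim : Empty → M)
  let t : (lascarEquiv L M ι).Classes → Set (L.Formula (ι ⊕ ℕ)) := fun α =>
    {φ | φ.Realize (Sum.elim (Quotient.out α) n)}
  have ht : Function.Injective t := by
    intro α β h
    have h1 : SameType L (Sum.elim (Quotient.out α) n) (Sum.elim (Quotient.out β) n) := fun φ =>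
      Set.ext_iff.1 h φ
    obtain ⟨k, hk⟩ := hsat.exists_aut_of_continuum_lt hM h1
    rw [Sum.comp_elim, Sum.elim_eq_iff] at hk
    rw [← Quotient.out_eq α, ← Quotient.out_eq β]
    exact Quotient.sound ⟨k, mem_autf_of_fix hn hk.2, hk.1⟩
  have h1 := lift_mk_le_lift_mk_of_injective ht
  rw [mk_set, lift_power, lift_two] at h1
  have h2 : lift.{w} #(L.Formula (ι ⊕ ℕ)) ≤ ℵ₀ := by
    rw [lift_le_aleph0]
    exact mk_le_aleph0
  have h3 := h1.trans (power_le_power_left two_ne_zero h2)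
  rw [two_power_aleph0, lift_le_continuum] at h3
  exact h3

theorem mk_gal_le [Countable L.Symbols] (hsat : IsSaturated L M) (hM : 𝔠 < #M) :
    #(Gal L M) ≤ 𝔠 := by
  obtain ⟨n, hn, -⟩ := exists_isModelTuple (L := L) (aleph0_lt_continuum.trans hM).le
    (Empty.elim : Empty → M)
  refine (mk_le_of_injective (f := fun γ : Gal L M =>
    (lascarEquiv L M ℕ).cls ((Quotient.out γ : M ≃[L] M) ∘ n)) ?_).trans
    (lascarEquiv_isBounded hsat hM ℕ)
  intro γ δ h
  obtain ⟨h, hh, heq⟩ := (lascarEquiv L M ℕ).cls_eq_iff.1 h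
  rw [← Gal.mk_out γ, ← Gal.mk_out δ]
  exact Gal.mk_eq_mk_of_comp_eq hn hh heq

/-- An ultra-imaginary element that is fixed by all strong automorphisms is bounded. -/
theorem isBoundedElt_of_autf_smul_eq [Countable L.Symbols] (hsat : IsSaturated L M) (hM : 𝔠 < #M)
    {ι : Type} {E : InvEquiv L M ι} {α : E.Classes} (h : ∀ f ∈ Autf L M, f • α = α) :
    InvEquiv.IsBoundedElt α := by
  refine le_trans ?_ (mk_gal_le hsat hM)
  refine mk_le_of_surjective (f := fun γ : Gal L M =>
    (⟨(Quotient.out γ : M ≃[L] M) • α, _, rfl⟩ : MulAction.orbit (M ≃[L] M) α)) ?_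
  rintro ⟨_, f, rfl⟩
  refine ⟨Gal.mk f, Subtype.ext ?_⟩
  have h1 := h _ (Gal.mk_eq_mk_iff.1 (Gal.mk_out (Gal.mk f)))
  rwa [mul_smul, inv_smul_eq_iff] at h1

/-- All `f i ∘ n` have the type of `n`, so a realization of the limit type is conjugate to `n`. -/
theorem exists_limAt (hsat : IsSaturated L M) (hM : 𝔠 < #M) {I : Type*} (U : Ultrafilter I)
    (n : ℕ → M) (f : I → (M ≃[L] M)) : ∃ g, LimAt U n f g := by
  obtain ⟨c, hc⟩ := hsat.exists_typeLim hM U (fun i => f i ∘ n) n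
  have h1 : SameType L n c := TypeLim.sameType (U := U) (x := fun i => f i ∘ n)
    (.of_forall_sameType fun i => .aut (f i) n) (hc.comp Sum.inl)
  obtain ⟨g, rfl⟩ := hsat.exists_aut_of_continuum_lt hM h1
  exact ⟨g, hc⟩

theorem LimAt.congr {I : Type*} {U : Ultrafilter I} {n : ℕ → M} {f f' : I → (M ≃[L] M)}
    {g : M ≃[L] M} (h : LimAt U n f g) (hf : ∀ᶠ i in (U : Filter I), f i = f' i) :
    LimAt U n f' g :=
  TypeLim.congr h (hf.mono fun i hi => by rw [hi]; exact .refl _)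

theorem LimAt.mk_eq (hsat : IsSaturated L M) (hM : 𝔠 < #M) {I : Type*} {U : Ultrafilter I}
    {n : ℕ → M} (hn : IsModelTuple L n) {f : I → (M ≃[L] M)} {g g' : M ≃[L] M}
    (h : LimAt U n f g) (h' : LimAt U n f g') : Gal.mk g = Gal.mk g' :=
  Gal.mk_eq_mk_of_sameType hsat hM hn (TypeLim.sameType h h')

theorem LimAt.const {I : Type*} (U : Ultrafilter I) (n : ℕ → M) (g : M ≃[L] M) :
    LimAt U n (fun _ => g) g := TypeLim.const _

/-- Applying `f⁻¹` turns the pair (n, f n) into (f⁻¹ n, n), so inversion just swaps the two halves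
of the type. -/
theorem LimAt.inv {I : Type*} {U : Ultrafilter I} {n : ℕ → M} {f : I → (M ≃[L] M)}
    {g : M ≃[L] M} (h : LimAt U n f g) : LimAt U n (fun i => (f i)⁻¹) g⁻¹ := by
  have key : ∀ f : M ≃[L] M, SameType L (Sum.elim n (f ∘ n))
      (Sum.elim ((f⁻¹ : M ≃[L] M) ∘ n) n) := by
    intro f
    have := (SameType.aut f⁻¹ (Sum.elim n (f ∘ n))).symm
    rwa [Sum.comp_elim, show (f⁻¹ : M ≃[L] M) ∘ f ∘ n = n from
      funext fun k => aut_inv_apply_self f _] at this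
  have h1 := TypeLim.comp h Sum.swap
  have e : ∀ f : M ≃[L] M, Sum.elim (f ∘ n) n ∘ Sum.swap = Sum.elim n (f ∘ n) := fun f => by
    funext k; rcases k with k | k <;> rfl
  simp only [e] at h1
  exact (h1.congr (Filter.Eventually.of_forall fun i => key (f i))).of_sameType (key g)

/-- The limit of the pairs (f n, f f' n) over `n` is realized jointly. The pair has the type of (n,
f' n), whose limit is that of (n, g' n), so the realization is (k n, k g' n). Here `k` may differ
from `g` but has the same class. -/
theorem LimAt.mul (hsat : IsSaturated L M) (hM : 𝔠 < #M) {I : Type*} {U : Ultrafilter I}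
    {n : ℕ → M} (hn : IsModelTuple L n) {f f' : I → (M ≃[L] M)} {g g' : M ≃[L] M}
    (h : LimAt U n f g) (h' : LimAt U n f' g') :
    ∃ k, Gal.mk k = Gal.mk g ∧ LimAt U n (fun i => f i * f' i) (k * g') := by
  obtain ⟨c, hc⟩ := hsat.exists_typeLim hM U
    (fun i => Sum.elim (f i ∘ n) ((f i * f' i : M ≃[L] M) ∘ n)) n
  have e : ∀ f : M ≃[L] M, Sum.elim (f ∘ n) n ∘ Sum.swap = Sum.elim n (f ∘ n) := fun f => by
    funext k; rcases k with k | k <;> rfl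
  have h1 := TypeLim.comp h' Sum.swap
  simp only [e] at h1
  have h2 : TypeLim L U (fun i => Sum.elim (f i ∘ n) ((f i * f' i : M ≃[L] M) ∘ n))
      (Sum.elim n (g' ∘ n)) := by
    refine h1.congr (Filter.Eventually.of_forall fun i => ?_)
    have := (SameType.aut (f i) (Sum.elim n (f' i ∘ n))).symm
    rwa [Sum.comp_elim] at this
  obtain ⟨k, hk⟩ := hsat.exists_aut_of_continuum_lt hM (h2.sameType (hc.comp Sum.inl))
  rw [Sum.comp_elim] at hk
  have hk1 : TypeLim L U (fun i => Sum.elim (f i ∘ n) n) (Sum.elim (k ∘ n) n) := by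
    have := hc.comp (Sum.map Sum.inl id)
    simp only [Sum.elim_comp_map, Sum.elim_comp_inl, Function.comp_id] at this
    rwa [show c ∘ Sum.inl = k ∘ n from by simpa using (congrArg (· ∘ Sum.inl) hk).symm] at this
  have hk2 : TypeLim L U (fun i => Sum.elim ((f i * f' i : M ≃[L] M) ∘ n) n)
      (Sum.elim ((k * g' : M ≃[L] M) ∘ n) n) := by
    have := hc.comp (Sum.map Sum.inr id)
    simp only [Sum.elim_comp_map, Sum.elim_comp_inr, Function.comp_id] at this
    rwa [show c ∘ Sum.inr = (k * g' : M ≃[L] M) ∘ n from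
      (congrArg (· ∘ Sum.inr) hk).symm] at this
  exact ⟨k, LimAt.mk_eq hsat hM hn hk1 h, hk2⟩

/-- A limit of automorphisms, defined by the action on a model, describes the limit of the action on
all bounded classes. -/
theorem LimAt.exists_r [Countable L.Symbols] (hsat : IsSaturated L M) (hM : 𝔠 < #M) {I : Type*}
    {U : Ultrafilter I} {n : ℕ → M} (hn : IsModelTuple L n) {f : I → (M ≃[L] M)} {g : M ≃[L] M}
    (h : LimAt U n f g) {ι : Type} [Countable ι] (E : InvEquiv L M ι) (hE : E.IsBounded)
    (a : ι → M) : ∃ d, E.r d (g ∘ a) ∧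
      TypeLim L U (fun i => Sum.elim (f i ∘ a) (g ∘ a)) (Sum.elim d (g ∘ a)) := by
  -- The images of `n` and `a` are taken to the limit together: the first part makes `k` a limit of
  -- the family, so `k` and `g` agree on bounded classes; the second part is the required `d`.
  obtain ⟨c, hc⟩ := hsat.exists_typeLim hM U (fun i => Sum.elim (f i ∘ n) (f i ∘ a))
    (Sum.elim n (g ∘ a))
  have h1 : TypeLim L U (fun i => Sum.elim (f i ∘ n) (f i ∘ a)) (Sum.elim n a) :=
    .of_forall_sameType fun i => by
      rw [← Sum.comp_elim]
      exact .aut _ _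
  obtain ⟨k, hk⟩ := hsat.exists_aut_of_continuum_lt hM (h1.sameType (hc.comp Sum.inl))
  rw [Sum.comp_elim] at hk
  have hk1 : LimAt U n f k := by
    have := hc.comp (Sum.map Sum.inl Sum.inl)
    simp only [Sum.elim_comp_map, Sum.elim_comp_inl] at this
    rwa [show c ∘ Sum.inl = k ∘ n from by simpa using (congrArg (· ∘ Sum.inl) hk).symm] at this
  refine ⟨k ∘ a, E.cls_eq_iff.1 (smul_eq_smul_of_mk_eq hsat hM (hE.isBoundedElt (E.cls a))
    (hk1.mk_eq hsat hM hn h)), ?_⟩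
  have := hc.comp (Sum.map Sum.inr Sum.inr)
  simp only [Sum.elim_comp_map, Sum.elim_comp_inr] at this
  rwa [show c ∘ Sum.inr = k ∘ a from by simpa using (congrArg (· ∘ Sum.inr) hk).symm] at this

/-- Łoś's theorem replaces the ultrapower by limits of types in `M`. -/
theorem ultraRel_iff [Nonempty M] {I : Type w} (U : Ultrafilter I) (f : I → (M ≃[L] M))
    (g : M ≃[L] M) {ι : Type} (E : InvEquiv L M ι) (a : ι → M) :
    ultraRel U E (fun k => ultraAut U f (diag U (a k))) (fun k => diag U (g (a k))) ↔
      ∃ c d, E.r c d ∧ TypeLim L U (fun i => Sum.elim (f i ∘ a) (g ∘ a)) (Sum.elim c d) := by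
  refine exists_congr fun c => exists_congr fun d => and_congr_right fun _ =>
    forall_congr' fun φ => ?_
  have h1 := realize_ultrapower U φ (Sum.elim (fun k i => f i (a k)) fun k _ => g (a k))
  rw [show (fun k => ultraMk U ((Sum.elim (fun k i => f i (a k)) fun k _ => g (a k) :
      ι ⊕ ι → I → M) k)) = Sum.elim (fun k => ultraAut U f (diag U (a k)))
      (fun k => diag U (g (a k))) from by funext k; rcases k with k | k <;> rfl] at h1
  rw [h1]
  refine iff_comm.trans (iff_congr Iff.rfl (Filter.eventually_congr
    (Filter.Eventually.of_forall fun i => ?_)))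
  rw [show (fun k => (Sum.elim (fun k i => f i (a k)) fun k _ => g (a k) : ι ⊕ ι → I → M) k i) =
    Sum.elim (f i ∘ a) (g ∘ a) from by funext k; rcases k with k | k <;> rfl]

theorem LimAt.isUltraLimit [Countable L.Symbols] (hsat : IsSaturated L M) (hM : 𝔠 < #M)
    {I : Type w} {U : Ultrafilter I} {n : ℕ → M} (hn : IsModelTuple L n) {f : I → (M ≃[L] M)}
    {g : M ≃[L] M} (h : LimAt U n f g) : IsUltraLimit U f (Gal.mk g) := by
  have := nonempty_of_continuum_lt hM
  refine ⟨g, rfl, fun ι _ E hE a => (ultraRel_iff U f g E a).2 ?_⟩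
  obtain ⟨d, hd, hlim⟩ := h.exists_r hsat hM hn E hE a
  exact ⟨d, _, hd, hlim⟩

theorem IsUltraLimit.unique [Countable L.Symbols] (hsat : IsSaturated L M) (hM : 𝔠 < #M)
    {I : Type w} {U : Ultrafilter I} {f : I → (M ≃[L] M)} {β β' : Gal L M}
    (h : IsUltraLimit U f β) (h' : IsUltraLimit U f β') : β = β' := by
  have := nonempty_of_continuum_lt hM
  have hM0 := aleph0_lt_continuum.trans hM
  obtain ⟨n, hn, -⟩ := exists_isModelTuple (L := L) hM0.le (Empty.elim : Empty → M)
  obtain ⟨g, rfl, hg⟩ := h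
  obtain ⟨g', rfl, hg'⟩ := h'
  let E := lascarEquiv L M ℕ
  have hE := lascarEquiv_isBounded hsat hM (ι := ℕ)
  obtain ⟨c, d, hcd, hlim⟩ := (ultraRel_iff U f g E n).1 (hg ℕ E hE n)
  obtain ⟨c', d', hcd', hlim'⟩ := (ultraRel_iff U f g' E n).1 (hg' ℕ E hE n)
  -- One realization over both `g ∘ n` and `g' ∘ n` is conjugate to each under `Autf`.
  obtain ⟨e, he⟩ := hsat.exists_typeLim hM U (fun i => f i ∘ n) (Sum.elim (g ∘ n) (g' ∘ n))
  have h1 := he.comp (Sum.map id Sum.inl)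
  have h2 := he.comp (Sum.map id Sum.inr)
  simp only [Sum.elim_comp_map, Sum.elim_comp_inl, Sum.elim_comp_inr, Function.comp_id] at h1 h2
  have r1 := (E.r_iff_of_sameType hsat hM0 (hlim.sameType h1)).1 hcd
  have r2 := (E.r_iff_of_sameType hsat hM0 (hlim'.sameType h2)).1 hcd'
  obtain ⟨k, hk, hkn⟩ := E.iseqv.trans (E.iseqv.symm r1) r2
  exact Gal.mk_eq_mk_of_comp_eq hn hk hkn

theorem existsUnique_isUltraLimit [Countable L.Symbols] (hsat : IsSaturated L M) (hM : 𝔠 < #M)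
    {I : Type w} (U : Ultrafilter I) (f : I → (M ≃[L] M)) : ∃! β : Gal L M, IsUltraLimit U f β := by
  obtain ⟨n, hn, -⟩ := exists_isModelTuple (L := L) (aleph0_lt_continuum.trans hM).le
    (Empty.elim : Empty → M)
  obtain ⟨g, hg⟩ := exists_limAt hsat hM U n f
  exact ⟨_, hg.isUltraLimit hsat hM hn, fun β hβ => hβ.unique hsat hM (hg.isUltraLimit hsat hM hn)⟩

end Limits

/-! ### Closed sets of the topology are the ultra-closed sets -/

section ClosedSets

open FirstOrder.Language

variable {L : FirstOrder.Language.{u, v}} {M : Type w} [L.Structure M]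

/-- Changing the family off a set in the ultrafilter does not change its limit. -/
theorem IsUltraClosed.mk_mem_of_eventually [Countable L.Symbols] (hsat : IsSaturated L M)
    (hM : 𝔠 < #M) {X : Set (Gal L M)} (hX : IsUltraClosed X) {I : Type w} {U : Ultrafilter I}
    {n : ℕ → M} (hn : IsModelTuple L n) {f : I → (M ≃[L] M)} {g : M ≃[L] M}
    (h : LimAt U n f g) (hf : ∀ᶠ i in (U : Filter I), Gal.mk (f i) ∈ X) : Gal.mk g ∈ X := by
  classical
  obtain ⟨i₀, hi₀⟩ := hf.exists
  refine hX I U (fun i => if Gal.mk (f i) ∈ X then f i else f i₀) _ (fun i => ?_)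
    (LimAt.isUltraLimit hsat hM hn (h.congr (hf.mono fun i hi => (if_pos hi).symm)))
  split_ifs with hi
  · exact hi
  · exact hi₀

theorem isUltraClosed_of_limAt [Countable L.Symbols] (hsat : IsSaturated L M)
    (hM : 𝔠 < #M) {X : Set (Gal L M)} {n : ℕ → M} (hn : IsModelTuple L n)
    (h : ∀ (I : Type w) (U : Ultrafilter I) (f : I → (M ≃[L] M)) (g : M ≃[L] M),
      (∀ i, Gal.mk (f i) ∈ X) → LimAt U n f g → Gal.mk g ∈ X) : IsUltraClosed X := by
  intro I U f β hf hβ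
  obtain ⟨g, hg⟩ := exists_limAt hsat hM U n f
  rw [hβ.unique hsat hM (hg.isUltraLimit hsat hM hn)]
  exact h I U f g hf hg

/-- A family of conditions that are satisfied by automorphisms in a set, closed under conjunctions,
has a limit. -/
theorem exists_limAt_of_directed (hsat : IsSaturated L M) (hM : 𝔠 < #M) (n : ℕ → M) {B : Type*}
    (P : B → Prop) (S : B → Set (M ≃[L] M)) (hne : ∃ b, P b)
    (hdir : ∀ b c, P b → P c → ∃ d, P d ∧ S d ⊆ S b ∩ S c) (hS : ∀ b, P b → (S b).Nonempty) :
    ∃ (U : Ultrafilter (M ≃[L] M)) (g : M ≃[L] M), LimAt U n id g ∧ ∀ b, P b → S b ∈ U := by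
  obtain ⟨U, hU⟩ := exists_ultrafilter_of_directed P S hne hdir hS
  obtain ⟨g, hg⟩ := exists_limAt hsat hM U n id
  exact ⟨U, g, hg, hU⟩

/-- Membership in a closed set is given by the formulas that hold on the set. -/
theorem IsUltraClosed.mk_mem [Countable L.Symbols] (hsat : IsSaturated L M) (hM : 𝔠 < #M)
    {X : Set (Gal L M)} (hX : IsUltraClosed X) {n : ℕ → M} (hn : IsModelTuple L n) {g : M ≃[L] M}
    (h : ∀ θ : L.Formula (ℕ ⊕ ℕ), (∀ f : M ≃[L] M, Gal.mk f ∈ X →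
      θ.Realize (Sum.elim (f ∘ n) n)) → θ.Realize (Sum.elim (g ∘ n) n)) : Gal.mk g ∈ X := by
  obtain ⟨U, k, hk, hU⟩ := exists_limAt_of_directed hsat hM n
    (fun φ : L.Formula (ℕ ⊕ ℕ) => φ.Realize (Sum.elim (g ∘ n) n))
    (fun φ => {f | Gal.mk f ∈ X ∧ φ.Realize (Sum.elim (f ∘ n) n)}) ⟨⊤, by simp⟩
    (fun φ ψ hφ hψ => ⟨φ ⊓ ψ, by simp [hφ, hψ], by
      rintro f ⟨hf, h⟩
      rw [Formula.realize_inf] at h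
      exact ⟨⟨hf, h.1⟩, hf, h.2⟩⟩)
    (fun φ hφ => by
      by_contra hn
      refine (h φ.not fun f hf => ?_) hφ
      intro hf'
      exact hn ⟨f, hf, hf'⟩)
  have h1 : SameType L (Sum.elim (g ∘ n) n) (Sum.elim (k ∘ n) n) := .of_imp fun φ hφ =>
    (hk φ).2 (Filter.mem_of_superset (hU φ hφ) fun f hf => hf.2)
  rw [Gal.mk_eq_mk_of_sameType hsat hM hn h1]
  exact hX.mk_mem_of_eventually hsat hM hn hk
    (Filter.mem_of_superset (hU ⊤ (by simp)) fun f hf => hf.1)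

theorem IsUltraClosed.isClosed [Countable L.Symbols] (hsat : IsSaturated L M) (hM : 𝔠 < #M)
    {X : Set (Gal L M)} (hX : IsUltraClosed X) : IsClosed X := by
  obtain ⟨n, hn, -⟩ := exists_isModelTuple (L := L) (aleph0_lt_continuum.trans hM).le
    (Empty.elim : Empty → M)
  let E := lascarEquiv L M ℕ
  have hE : E.IsBounded := lascarEquiv_isBounded hsat hM ℕ
  -- The preimage of `Y` is cut out by the formulas over `n` true of all `f ∘ n` with class in `X`,
  -- and `X` is recovered as the preimage of `Y` since the orbit map at the class of `n` is
  -- injective.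
  let Y : Set E.Classes := {α | ∃ f : M ≃[L] M, Gal.mk f ∈ X ∧ E.cls (f ∘ n) = α}
  have hY : E.IsLogicClosed Y := by
    refine ⟨(fun φ : L.Formula (ℕ ⊕ ℕ) => {x | φ.Realize (Sum.elim x n)}) ''
      {φ | ∀ f : M ≃[L] M, Gal.mk f ∈ X → φ.Realize (Sum.elim (f ∘ n) n)}, ?_, ?_, ?_⟩
    · exact (Set.to_countable _).image _ |>.le_aleph0.trans aleph0_le_continuum
    · rintro _ ⟨φ, -, rfl⟩
      rw [Set.definable_iff_exists_formula_sum]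
      refine ⟨φ.relabel (Sum.elim Sum.inr fun k => Sum.inl ⟨n k, Set.mem_univ _⟩), ?_⟩
      ext x
      rw [Set.mem_ofPred_eq, Set.mem_ofPred_eq, Formula.realize_relabel]
      rw [show (Sum.elim (fun y : (Set.univ : Set M) => (y : M)) x ∘
        Sum.elim Sum.inr fun k => Sum.inl ⟨n k, Set.mem_univ _⟩) = Sum.elim x n from by
          funext k; rcases k with k | k <;> rfl]
    · ext x
      constructor
      · rintro ⟨f, hf, hfx⟩
        obtain ⟨h, hh, rfl⟩ := E.cls_eq_iff.1 hfx
        rintro _ ⟨φ, hφ, rfl⟩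
        refine hφ (h * f) ?_
        rwa [Gal.mk_mul, Gal.mk_eq_one_iff.2 hh, one_mul]
      · intro hx
        obtain ⟨g, rfl⟩ : ∃ g : M ≃[L] M, g ∘ n = x := by
          refine hsat.exists_aut_of_continuum_lt hM (.of_imp fun φ hφ => ?_)
          have := hx _ ⟨φ.relabel Sum.inl, fun f _ => by
            rw [Formula.realize_relabel, Sum.elim_comp_inl]
            exact (SameType.aut f n φ).2 hφ, rfl⟩
          rwa [Set.mem_ofPred_eq, Formula.realize_relabel, Sum.elim_comp_inl] at this
        refine ⟨g, hX.mk_mem hsat hM hn fun θ hθ => ?_, rfl⟩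
        exact hx _ ⟨θ, hθ, rfl⟩
  have hpre : (fun γ : Gal L M => galAct γ (E.cls n)) ⁻¹' Y = X := by
    ext γ
    obtain ⟨g, rfl⟩ := Gal.mk_surjective γ
    rw [Set.mem_preimage, galAct_mk hsat hM (hE.isBoundedElt _), InvEquiv.smul_cls]
    constructor
    · rintro ⟨f, hf, hfg⟩
      obtain ⟨h, hh, heq⟩ := E.cls_eq_iff.1 hfg
      rwa [← Gal.mk_eq_mk_of_comp_eq hn hh heq]
    · exact fun hg => ⟨g, hg, rfl⟩
  have h1 : @IsClosed _ (TopologicalSpace.induced (fun γ : Gal L M => galAct γ (E.cls n))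
      (E.logicTopology hE)) X := by
    refine (@isClosed_induced_iff _ _ (E.logicTopology hE) _ _).2 ⟨Y, ?_, hpre⟩
    rw [← @isOpen_compl_iff _ _ (E.logicTopology hE)]
    change Yᶜᶜ ∈ {X | E.IsLogicClosed X}
    rwa [compl_compl]
  refine IsClosed.mono h1 ?_
  exact (iInf_le _ ℕ).trans <| (iInf_le _ (inferInstance : Countable ℕ)).trans <|
    (iInf_le _ E).trans <| (iInf_le _ hE).trans (iInf_le _ _)

/-- The limit of the `f i ∘ a` is realized over the at most 𝔠 parameters defining `X` and over `g ∘
a` at once: the former puts its class in `X`, the latter makes it equivalent to `g ∘ a`. -/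
theorem isUltraClosed_preimage [Countable L.Symbols] (hsat : IsSaturated L M) (hM : 𝔠 < #M)
    {ι : Type} [Countable ι] {E : InvEquiv L M ι} (hE : E.IsBounded) (α : E.Classes)
    {X : Set E.Classes} (hX : E.IsLogicClosed X) :
    IsUltraClosed ((fun γ : Gal L M => galAct γ α) ⁻¹' X) := by
  have hM0 := aleph0_lt_continuum.trans hM
  obtain ⟨n, hn, -⟩ := exists_isModelTuple (L := L) hM0.le (Empty.elim : Empty → M)
  induction α using Quotient.inductionOn with
  | h a =>
    change IsUltraClosed ((fun γ : Gal L M => galAct γ (E.cls a)) ⁻¹' X)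
    refine isUltraClosed_of_limAt hsat hM hn fun I U f g hf hg => ?_
    simp only [Set.mem_preimage, galAct_mk hsat hM (hE.isBoundedElt _), InvEquiv.smul_cls] at hf ⊢
    obtain ⟨S, hSc, hSd, hS⟩ := hX
    obtain ⟨d', hd', hlim⟩ := hg.exists_r hsat hM hn E hE a
    choose! A _ hA using fun s hs => Set.definable_iff_finitely_definable.1 (hSd s hs)
    let B : Set M := ⋃ s : S, (A s : Set M)
    have hB : #B ≤ 𝔠 := by
      refine (mk_iUnion_le _).trans ?_
      refine (mul_le_mul' hSc (ciSup_le' fun s => ?_)).trans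
        (mul_eq_self aleph0_le_continuum).le
      exact (A s).finite_toSet.countable.le_aleph0.trans aleph0_le_continuum
    obtain ⟨d, hd⟩ := hsat.exists_limit hM0.le U (fun i => f i ∘ a)
      (Sum.elim ((↑) : B → M) (g ∘ a)) (by
        refine lt_of_le_of_lt ?_ hM
        rw [Set.Sum.elim_range, Subtype.range_coe]
        refine (mk_union_le _ _).trans (add_le_of_le aleph0_le_continuum hB ?_)
        exact (Set.countable_range _).le_aleph0.trans aleph0_le_continuum)
    have hd : TypeLim L U (fun i => Sum.elim (f i ∘ a) (Sum.elim ((↑) : B → M) (g ∘ a)))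
        (Sum.elim d (Sum.elim ((↑) : B → M) (g ∘ a))) := hd
    have hdX : E.cls d ∈ X := by
      change d ∈ E.cls ⁻¹' X
      rw [hS]
      intro s hs
      obtain ⟨φ, hφ⟩ := Set.definable_iff_exists_formula_sum.1 (hA s hs)
      let τ : (A s : Set M) ⊕ ι → ι ⊕ (B ⊕ ι) :=
        Sum.elim (fun m => Sum.inr (Sum.inl ⟨m, Set.mem_iUnion.2 ⟨⟨s, hs⟩, m.2⟩⟩)) Sum.inl
      have hτ : ∀ x : ι → M, Sum.elim x (Sum.elim ((↑) : B → M) (g ∘ a)) ∘ τ =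
          Sum.elim (fun y : (A s : Set M) => (y : M)) x := fun x => by
        funext k; rcases k with k | k <;> rfl
      have h1 := hd.comp τ
      simp only [hτ] at h1
      rw [hφ]
      refine h1.realize_of_eventually (Filter.Eventually.of_forall fun i => ?_)
      have : f i ∘ a ∈ s := by
        have h2 : f i ∘ a ∈ E.cls ⁻¹' X := hf i
        rw [hS] at h2
        exact h2 s hs
      rw [hφ] at this
      exact this
    have h2 := hd.comp (Sum.map id Sum.inr)
    simp only [Sum.elim_comp_map, Sum.elim_comp_inr, Function.comp_id] at h2
    have h3 := (E.r_iff_of_sameType hsat hM0 (hlim.sameType h2)).1 hd'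
    rwa [← E.cls_eq_iff.2 h3]

theorem IsUltraClosed.union [Countable L.Symbols] (hsat : IsSaturated L M) (hM : 𝔠 < #M)
    {X Y : Set (Gal L M)} (hX : IsUltraClosed X) (hY : IsUltraClosed Y) :
    IsUltraClosed (X ∪ Y) := by
  obtain ⟨n, hn, -⟩ := exists_isModelTuple (L := L) (aleph0_lt_continuum.trans hM).le
    (Empty.elim : Empty → M)
  refine isUltraClosed_of_limAt hsat hM hn fun I U f g hf hg => ?_
  have : ∀ᶠ i in (U : Filter I), Gal.mk (f i) ∈ X ∨ Gal.mk (f i) ∈ Y :=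
    Filter.Eventually.of_forall hf
  rcases Ultrafilter.eventually_or.1 this with h | h
  · exact Or.inl (hX.mk_mem_of_eventually hsat hM hn hg h)
  · exact Or.inr (hY.mk_mem_of_eventually hsat hM hn hg h)

theorem isClosed_iff_isUltraClosed [Countable L.Symbols] (hsat : IsSaturated L M) (hM : 𝔠 < #M)
    {X : Set (Gal L M)} : IsClosed X ↔ IsUltraClosed X := by
  refine ⟨fun hX => ?_, fun hX => hX.isClosed hsat hM⟩
  -- The ultra-closed sets form a topology making all orbit maps continuous, hence one finer than
  -- the coarsest such topology.
  let t : TopologicalSpace (Gal L M) := TopologicalSpace.ofClosed {X | IsUltraClosed X}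
    (fun I U f β hf _ => by
      obtain ⟨i⟩ := U.neBot.nonempty_of_mem Filter.univ_mem |>.to_type
      exact hf i)
    (fun F hF I U f β hf hβ Y hY => hF hY I U f β (fun i => hf i Y hY) hβ)
    (fun X hX Y hY => IsUltraClosed.union hsat hM hX hY)
  have ht : ∀ X : Set (Gal L M), @IsClosed _ t X ↔ IsUltraClosed X := fun X => by
    rw [← @isOpen_compl_iff _ _ t]
    change Xᶜᶜ ∈ {X | IsUltraClosed X} ↔ _
    rw [compl_compl, Set.mem_ofPred_eq]
  have hle : t ≤ galTopology := by
    refine le_iInf fun ι => le_iInf fun hι => le_iInf fun E => le_iInf fun hE => le_iInf fun α => ?_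
    rw [← continuous_iff_le_induced]
    refine (@continuous_iff_isClosed _ _ t (E.logicTopology hE) _).2 fun Y hY => ?_
    rw [ht]
    refine isUltraClosed_preimage hsat hM hE α ?_
    rw [← @isOpen_compl_iff _ _ (E.logicTopology hE)] at hY
    change Yᶜᶜ ∈ {X | E.IsLogicClosed X} at hY
    rwa [compl_compl] at hY
  exact (ht X).1 (IsClosed.mono hX hle)

end ClosedSets

/-! ### Compactness and the topological group structure -/

section GaloisTopology

open FirstOrder.Language Topology

variable {L : FirstOrder.Language.{u, v}} {M : Type w} [L.Structure M]

theorem mk_mem_of_isClosed [Countable L.Symbols] (hsat : IsSaturated L M)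
    (hM : 𝔠 < #M) {X : Set (Gal L M)} (hX : IsClosed X) {I : Type w} {U : Ultrafilter I}
    {n : ℕ → M} (hn : IsModelTuple L n) {f : I → (M ≃[L] M)} {g : M ≃[L] M}
    (h : LimAt U n f g) (hf : ∀ᶠ i in (U : Filter I), Gal.mk (f i) ∈ X) : Gal.mk g ∈ X :=
  ((isClosed_iff_isUltraClosed hsat hM).1 hX).mk_mem_of_eventually hsat hM hn h hf

theorem isClosed_of_limAt [Countable L.Symbols] (hsat : IsSaturated L M)
    (hM : 𝔠 < #M) {X : Set (Gal L M)} {n : ℕ → M} (hn : IsModelTuple L n)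
    (h : ∀ (I : Type w) (U : Ultrafilter I) (f : I → (M ≃[L] M)) (g : M ≃[L] M),
      (∀ i, Gal.mk (f i) ∈ X) → LimAt U n f g → Gal.mk g ∈ X) : IsClosed X :=
  (isClosed_iff_isUltraClosed hsat hM).2 (isUltraClosed_of_limAt hsat hM hn h)

theorem LimAt.tendsto [Countable L.Symbols] (hsat : IsSaturated L M) (hM : 𝔠 < #M) {I : Type w}
    {U : Ultrafilter I} {n : ℕ → M} (hn : IsModelTuple L n) {f : I → (M ≃[L] M)} {g : M ≃[L] M}
    (h : LimAt U n f g) : Filter.Tendsto (fun i => Gal.mk (f i)) U (𝓝 (Gal.mk g)) := by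
  refine tendsto_nhds.2 fun O hO hg => ?_
  by_contra hn'
  rw [← Ultrafilter.mem_coe.symm.eq, ← Ultrafilter.compl_mem_iff_notMem] at hn'
  exact mk_mem_of_isClosed hsat hM hO.isClosed_compl hn h hn' hg

/-- An ultrafilter on the group converges to the class of a limit of chosen lifts. -/
theorem gal_compactSpace [Countable L.Symbols] (hsat : IsSaturated L M) (hM : 𝔠 < #M) :
    CompactSpace (Gal L M) := by
  obtain ⟨n, hn, -⟩ := exists_isModelTuple (L := L) (aleph0_lt_continuum.trans hM).le
    (Empty.elim : Empty → M)
  refine ⟨isCompact_iff_ultrafilter_le_nhds.2 fun U _ => ?_⟩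
  obtain ⟨g, hg⟩ := exists_limAt hsat hM U n (fun γ : Gal L M => (Quotient.out γ : M ≃[L] M))
  refine ⟨Gal.mk g, Set.mem_univ _, ?_⟩
  have := hg.tendsto hsat hM hn
  simp only [Gal.mk_out] at this
  exact this

theorem gal_continuous_mul_left [Countable L.Symbols] (hsat : IsSaturated L M) (hM : 𝔠 < #M)
    (γ : Gal L M) : Continuous (γ * ·) := by
  obtain ⟨n, hn, -⟩ := exists_isModelTuple (L := L) (aleph0_lt_continuum.trans hM).le
    (Empty.elim : Empty → M)
  obtain ⟨k, rfl⟩ := Gal.mk_surjective γ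
  refine continuous_iff_isClosed.2 fun X hX => isClosed_of_limAt hsat hM hn fun I U f g hf hg => ?_
  obtain ⟨k', hk', hlim⟩ := (LimAt.const U n k).mul hsat hM hn hg
  change Gal.mk k * Gal.mk g ∈ X
  rw [← hk']
  exact mk_mem_of_isClosed hsat hM hX hn hlim (Filter.Eventually.of_forall hf)

theorem gal_continuous_mul_right [Countable L.Symbols] (hsat : IsSaturated L M) (hM : 𝔠 < #M)
    (γ : Gal L M) : Continuous (· * γ) := by
  obtain ⟨n, hn, -⟩ := exists_isModelTuple (L := L) (aleph0_lt_continuum.trans hM).le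
    (Empty.elim : Empty → M)
  obtain ⟨k, rfl⟩ := Gal.mk_surjective γ
  refine continuous_iff_isClosed.2 fun X hX => isClosed_of_limAt hsat hM hn fun I U f g hf hg => ?_
  obtain ⟨g', hg', hlim⟩ := hg.mul hsat hM hn (LimAt.const U n k)
  change Gal.mk g * Gal.mk k ∈ X
  rw [← hg']
  exact mk_mem_of_isClosed hsat hM hX hn hlim (Filter.Eventually.of_forall hf)

theorem gal_continuous_inv [Countable L.Symbols] (hsat : IsSaturated L M) (hM : 𝔠 < #M) :
    Continuous fun γ : Gal L M => γ⁻¹ := by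
  obtain ⟨n, hn, -⟩ := exists_isModelTuple (L := L) (aleph0_lt_continuum.trans hM).le
    (Empty.elim : Empty → M)
  refine continuous_iff_isClosed.2 fun X hX => isClosed_of_limAt hsat hM hn fun I U f g hf hg => ?_
  exact mk_mem_of_isClosed hsat hM hX hn hg.inv (Filter.Eventually.of_forall hf)

theorem realize_comp_iff (g f : M ≃[L] M) {ι κ : Type*} (a : ι → M) (b : κ → M)
    (θ : L.Formula (ι ⊕ κ)) :
    θ.Realize (Sum.elim ((g⁻¹ * f : M ≃[L] M) ∘ a) b) ↔
      θ.Realize (Sum.elim (f ∘ a) (g ∘ b)) := by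
  rw [← SameType.aut g _ θ, Sum.comp_elim]
  rw [show g ∘ (g⁻¹ * f : M ≃[L] M) ∘ a = f ∘ a from
    funext fun k => aut_apply_inv_self g (f (a k))]

/-- A class outside the closure of the identity is separated from the identity. -/
theorem gal_disjoint_nhds_one [Countable L.Symbols] (hsat : IsSaturated L M) (hM : 𝔠 < #M)
    {η : Gal L M} (hη : ¬ (1 : Gal L M) ⤳ η) : Disjoint (𝓝 (1 : Gal L M)) (𝓝 η) := by
  obtain ⟨n, hn, -⟩ := exists_isModelTuple (L := L) (aleph0_lt_continuum.trans hM).le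
    (Empty.elim : Empty → M)
  obtain ⟨g, rfl⟩ := Gal.mk_surjective η
  let H : Set (Gal L M) := {x | (1 : Gal L M) ⤳ x}
  have hH : IsClosed H := by
    have : H = closure {1} := Set.ext fun x => specializes_iff_mem_closure
    rw [this]
    exact isClosed_closure
  have hmul : ∀ x y, x ∈ H → y ∈ H → x * y ∈ H := by
    intro x y hx hy
    have := Specializes.map hy (gal_continuous_mul_left hsat hM x)
    simp only [mul_one] at this
    exact Specializes.trans hx this
  have hinv : ∀ x, x ∈ H → x⁻¹ ∈ H := by
    intro x hx
    have := Specializes.map hx (gal_continuous_inv hsat hM)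
    rwa [inv_one] at this
  -- If every `θ` true on `H` failed to separate, compactness would give a `k` with the classes of
  -- both `k` and `g⁻¹ k` in the subgroup `H`, forcing the class of `g` into `H`.
  obtain ⟨θ, hθ, hθg⟩ : ∃ θ : L.Formula (ℕ ⊕ ℕ),
      (∀ h : M ≃[L] M, Gal.mk h ∈ H → θ.Realize (Sum.elim (h ∘ n) n)) ∧
      ∀ f : M ≃[L] M, θ.Realize (Sum.elim (f ∘ n) n) → ¬ θ.Realize (Sum.elim (f ∘ n) (g ∘ n)) := by
    by_contra! hcon
    obtain ⟨U, k, hk, hU⟩ := exists_limAt_of_directed hsat hM n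
      (fun θ : L.Formula (ℕ ⊕ ℕ) =>
        ∀ h : M ≃[L] M, Gal.mk h ∈ H → θ.Realize (Sum.elim (h ∘ n) n))
      (fun θ => {f | θ.Realize (Sum.elim (f ∘ n) n) ∧ θ.Realize (Sum.elim (f ∘ n) (g ∘ n))})
      ⟨⊤, by simp⟩
      (fun θ θ' h h' => ⟨θ ⊓ θ', fun f hf => by
          rw [Formula.realize_inf]
          exact ⟨h f hf, h' f hf⟩, by
        rintro f ⟨h1, h2⟩
        rw [Formula.realize_inf] at h1 h2
        exact ⟨⟨h1.1, h2.1⟩, h1.2, h2.2⟩⟩)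
      (fun θ hθ => hcon θ hθ)
    have hU' := (isClosed_iff_isUltraClosed hsat hM).1 hH
    have hk1 : Gal.mk k ∈ H := hU'.mk_mem hsat hM hn fun θ hθ =>
      (hk θ).2 (Filter.mem_of_superset (hU θ hθ) fun f hf => hf.1)
    obtain ⟨p, hp, hlim⟩ := (LimAt.const U n g⁻¹).mul hsat hM hn hk
    have hk2 : Gal.mk (p * k) ∈ H := hU'.mk_mem hsat hM hn fun θ hθ =>
      (hlim θ).2 (Filter.mem_of_superset (hU θ hθ) fun f hf => (realize_comp_iff g f n n θ).2 hf.2)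
    rw [Gal.mk_mul, hp, Gal.mk_inv] at hk2
    have := hmul _ _ hk1 (hinv _ hk2)
    rw [mul_inv_rev, inv_inv, mul_inv_cancel_left] at this
    exact hη this
  -- `C g` collects the cosets of `H` containing some `f` that violates `θ` at `g ∘ n`. By choice of
  -- `θ`, `C 1` omits 1, `C g` omits the class of `g`, and together they cover the group.
  let C : (M ≃[L] M) → Set (Gal L M) := fun g =>
    {γ | ∃ f : M ≃[L] M, γ⁻¹ * Gal.mk f ∈ H ∧ ¬ θ.Realize (Sum.elim (f ∘ n) (g ∘ n))}
  have hC : ∀ g, IsClosed (C g) := by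
    intro g
    refine isClosed_of_limAt hsat hM hn fun I U f e hf he => ?_
    choose k hkH hkθ using hf
    -- Translating by `g⁻¹` makes the condition at `g ∘ n` a formula over `n`, which passes to the
    -- limit.
    obtain ⟨m, hm⟩ := exists_limAt hsat hM U n fun i => g⁻¹ * k i
    obtain ⟨p, hp, hlim1⟩ := (LimAt.const U n g).mul hsat hM hn hm
    obtain ⟨q, hq, hlim2⟩ := he.inv.mul hsat hM hn hlim1
    refine ⟨g * m, ?_, ?_⟩
    · have := mk_mem_of_isClosed hsat hM hH hn hlim2 (Filter.Eventually.of_forall fun i => by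
        simpa [Gal.mk_mul, Gal.mk_inv] using hkH i)
      rwa [Gal.mk_mul, Gal.mk_mul, hp, hq] at this
    · rw [← realize_comp_iff, inv_mul_cancel_left]
      have := (hm θ.not).2 (Filter.Eventually.of_forall fun i => by
        rw [Formula.realize_not, realize_comp_iff]
        exact hkθ i)
      exact this
  refine Filter.disjoint_iff.2 ⟨(C 1)ᶜ, (hC 1).isOpen_compl.mem_nhds ?_, (C g)ᶜ,
    (hC g).isOpen_compl.mem_nhds ?_, ?_⟩
  · rintro ⟨f, hf, hn'⟩
    rw [inv_one, one_mul] at hf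
    exact hn' (hθ f hf)
  · rintro ⟨f, hf, hn'⟩
    exact hn' ((realize_comp_iff g f n n θ).1 (hθ _ hf))
  · rw [Set.disjoint_compl_left_iff_subset]
    intro γ hγ
    obtain ⟨f, rfl⟩ := Gal.mk_surjective γ
    have h1 : (Gal.mk f)⁻¹ * Gal.mk f ∈ H := by
      rw [inv_mul_cancel]
      exact specializes_rfl
    by_contra h2
    refine hθg f ?_ ?_
    · by_contra h3
      exact h2 ⟨f, h1, h3⟩
    · by_contra h3
      exact hγ ⟨f, h1, h3⟩

theorem gal_r1Space [Countable L.Symbols] (hsat : IsSaturated L M) (hM : 𝔠 < #M) :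
    R1Space (Gal L M) := by
  refine ⟨fun γ δ => ?_⟩
  by_cases h : (1 : Gal L M) ⤳ (γ⁻¹ * δ)
  · left
    have := h.map (gal_continuous_mul_left hsat hM γ)
    simpa using this
  · right
    have hc := gal_continuous_mul_left hsat hM γ⁻¹
    refine Filter.Tendsto.disjoint (f := (γ⁻¹ * ·)) ?_ (gal_disjoint_nhds_one hsat hM h)
      (hc.tendsto δ)
    have := hc.tendsto γ
    rwa [inv_mul_cancel] at this

/-- An ultrafilter of pairs tending to `x` also tends to the limits `a`, `b` of lifts, along which
products converge. In an R₁ space these specialize to the coordinates of `x`, and separate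
continuity carries this over to the product. -/
theorem gal_isTopologicalGroup [Countable L.Symbols] (hsat : IsSaturated L M) (hM : 𝔠 < #M) :
    IsTopologicalGroup (Gal L M) := by
  obtain ⟨n, hn, -⟩ := exists_isModelTuple (L := L) (aleph0_lt_continuum.trans hM).le
    (Empty.elim : Empty → M)
  have := gal_r1Space hsat hM
  refine { continuous_inv := gal_continuous_inv hsat hM, continuous_mul := ?_ }
  refine continuous_iff_ultrafilter.2 fun x W hW => ?_
  obtain ⟨a, ha⟩ := exists_limAt hsat hM W n fun p => (Quotient.out p.1 : M ≃[L] M)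
  obtain ⟨b, hb⟩ := exists_limAt hsat hM W n fun p => (Quotient.out p.2 : M ≃[L] M)
  obtain ⟨k, hk, hlim⟩ := ha.mul hsat hM hn hb
  have ha' := ha.tendsto hsat hM hn
  have hb' := hb.tendsto hsat hM hn
  have hlim' := hlim.tendsto hsat hM hn
  simp only [Gal.mk_out, Gal.mk_mul, hk] at ha' hb' hlim'
  have h1 : Gal.mk a ⤳ x.1 := by
    rw [specializes_iff_not_disjoint]
    exact fun hd => ha'.not_tendsto hd ((continuous_fst.tendsto x).mono_left hW)
  have h2 : Gal.mk b ⤳ x.2 := by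
    rw [specializes_iff_not_disjoint]
    exact fun hd => hb'.not_tendsto hd ((continuous_snd.tendsto x).mono_left hW)
  have h3 := (h1.map (gal_continuous_mul_right hsat hM (Gal.mk b))).trans
    (h2.map (gal_continuous_mul_left hsat hM x.1))
  exact hlim'.mono_right h3

end GaloisTopology

/-! ### Faithful actions, Hausdorffness and profiniteness -/

section Faithfulness

open FirstOrder.Language Topology

variable {L : FirstOrder.Language.{u, v}} {M : Type w} [L.Structure M]

theorem InvEquiv.IsDefinable.isTypeDefinable {ι : Type} {E : InvEquiv L M ι} (h : E.IsDefinable) :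
    E.IsTypeDefinable := by
  obtain ⟨φ, hφ⟩ := h
  exact ⟨{φ}, fun a b => by rw [hφ]; simp⟩

theorem LimAt.typeLim_comp {I : Type*} {U : Ultrafilter I} {n : ℕ → M} {f : I → (M ≃[L] M)}
    {g : M ≃[L] M} (h : LimAt U n f g) {ι : Type*} (σ : ι → ℕ) :
    TypeLim L U (fun i => Sum.elim (f i ∘ n ∘ σ) (n ∘ σ)) (Sum.elim (g ∘ n ∘ σ) (n ∘ σ)) := by
  have := TypeLim.comp h (Sum.map σ σ)
  simp only [Sum.elim_comp_map] at this
  exact this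

theorem galAct_mk_cls_eq_iff [Countable L.Symbols] (hsat : IsSaturated L M) (hM : 𝔠 < #M)
    {ι : Type} [Countable ι] {E : InvEquiv L M ι} {a : ι → M}
    (hα : InvEquiv.IsBoundedElt (E.cls a)) (f : M ≃[L] M) :
    galAct (Gal.mk f) (E.cls a) = E.cls a ↔ E.r (f ∘ a) a := by
  rw [galAct_mk hsat hM hα, InvEquiv.smul_cls, InvEquiv.cls_eq_iff]

/-- The stabilizer of a bounded hyperimaginary element is closed. -/
theorem isClosed_setOf_galAct_eq [Countable L.Symbols] (hsat : IsSaturated L M) (hM : 𝔠 < #M)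
    {ι : Type} [Countable ι] {E : InvEquiv L M ι} (hE : E.IsTypeDefinable) {α : E.Classes}
    (hα : InvEquiv.IsBoundedElt α) : IsClosed {γ : Gal L M | galAct γ α = α} := by
  induction α using Quotient.inductionOn with
  | h a =>
    change IsClosed {γ : Gal L M | galAct γ (E.cls a) = E.cls a}
    obtain ⟨S, hS⟩ := hE
    obtain ⟨n, hn, σ, rfl⟩ := exists_isModelTuple (L := L) (aleph0_lt_continuum.trans hM).le a
    refine isClosed_of_limAt hsat hM hn fun I U f g hf hg => ?_
    simp only [Set.mem_ofPred_eq, galAct_mk_cls_eq_iff hsat hM hα, hS] at hf ⊢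
    exact fun φ hφ => (hg.typeLim_comp σ φ).2 (Filter.Eventually.of_forall fun i => hf i φ hφ)

/-- The stabilizer of a bounded imaginary element is open. -/
theorem isOpen_setOf_galAct_eq [Countable L.Symbols] (hsat : IsSaturated L M) (hM : 𝔠 < #M)
    {ι : Type} [Countable ι] {E : InvEquiv L M ι} (hE : E.IsDefinable) {α : E.Classes}
    (hα : InvEquiv.IsBoundedElt α) : IsOpen {γ : Gal L M | galAct γ α = α} := by
  rw [← isClosed_compl_iff]
  induction α using Quotient.inductionOn with
  | h a =>
    change IsClosed {γ : Gal L M | galAct γ (E.cls a) = E.cls a}ᶜ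
    obtain ⟨ψ, hψ⟩ := hE
    obtain ⟨n, hn, σ, rfl⟩ := exists_isModelTuple (L := L) (aleph0_lt_continuum.trans hM).le a
    refine isClosed_of_limAt hsat hM hn fun I U f g hf hg => ?_
    simp only [Set.mem_compl_iff, Set.mem_ofPred_eq, galAct_mk_cls_eq_iff hsat hM hα, hψ] at hf ⊢
    exact (hg.typeLim_comp σ ψ.not).2 (Filter.Eventually.of_forall hf)

theorem t2Space_of_faithfulOnBddHyperimaginaries [Countable L.Symbols] (hsat : IsSaturated L M)
    (hM : 𝔠 < #M) (h : FaithfulOnBddHyperimaginaries L M) : T2Space (Gal L M) := by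
  have := gal_isTopologicalGroup hsat hM
  have hcl : IsClosed ({1} : Set (Gal L M)) := by
    refine isClosed_of_closure_subset fun γ hγ => h γ fun ι _ E hE α hα => ?_
    have h1 := closure_minimal (s := ({1} : Set (Gal L M))) ?_
      (isClosed_setOf_galAct_eq hsat hM hE hα)
    · exact h1 hγ
    · rintro _ rfl
      change galAct 1 α = α
      rw [← Gal.mk_one, galAct_mk hsat hM hα, one_smul]
  have := IsTopologicalGroup.t1Space (Gal L M) hcl
  infer_instance

theorem FirstOrder.Language.Formula.realize_congr {ι : Type*} [DecidableEq ι] {φ : L.Formula ι}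
    {x y : ι → M} (h : ∀ i ∈ φ.freeVarFinset, x i = y i) : φ.Realize x ↔ φ.Realize y := by
  rw [← Formula.realize_restrictVars φ x, ← Formula.realize_restrictVars φ y]
  rw [show (fun i : φ.freeVarFinset => x i) = fun i : φ.freeVarFinset => y i from
    funext fun i => h i i.2]

/-- Two tuples are equivalent if they are equal or if they are conjugate to `a` and equivalent under
strong automorphisms. -/
def lascarEquivOn {ι : Type} (a : ι → M) : InvEquiv L M ι where
  r x y := x = y ∨ ∃ s : M ≃[L] M, s ∘ a = x ∧ ∃ h ∈ Autf L M, h ∘ x = y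
  iseqv := by
    refine ⟨fun x => Or.inl rfl, ?_, ?_⟩
    · rintro x y (rfl | ⟨s, rfl, h, hh, rfl⟩)
      · exact Or.inl rfl
      · exact Or.inr ⟨h * s, rfl, h⁻¹, inv_mem hh, funext fun k => aut_inv_apply_self h (s (a k))⟩
    · rintro x y z (rfl | ⟨s, rfl, h, hh, rfl⟩) hyz
      · exact hyz
      · rcases hyz with rfl | ⟨_, -, h', hh', rfl⟩
        · exact Or.inr ⟨s, rfl, h, hh, rfl⟩
        · exact Or.inr ⟨s, rfl, h' * h, mul_mem hh' hh, rfl⟩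
  invariant := by
    rintro f x y (rfl | ⟨s, rfl, h, hh, rfl⟩)
    · exact Or.inl rfl
    · refine Or.inr ⟨f * s, rfl, f * h * f⁻¹, autf_normal.conj_mem h hh f, funext fun k => ?_⟩
      exact congrArg (fun y => f (h y)) (aut_inv_apply_self f (s (a k)))

/-- The defining set is that of all formulas true on the relation. For an unequal pair satisfying
it, after moving the first entry to `a`, compactness gives a limit `k` of strong automorphisms such
that (a, y) and (a, k a) have the same type. Closedness of {1} makes `k` strong, and conjugating `k`
gives a strong automorphism sending `a` to `y`. -/
theorem lascarEquivOn_isTypeDefinable [Countable L.Symbols] (hsat : IsSaturated L M) (hM : 𝔠 < #M)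
    (hcl : IsClosed ({1} : Set (Gal L M))) {n : ℕ → M} (hn : IsModelTuple L n) {ι : Type}
    [Finite ι] (σ : ι → ℕ) : (lascarEquivOn (L := L) (n ∘ σ)).IsTypeDefinable := by
  set a := n ∘ σ with ha
  set E := lascarEquivOn (L := L) a with hEdef
  let χ : L.Formula (ι ⊕ ι) := Formula.iInf fun i : ι =>
    Term.equal (Term.var (Sum.inl i)) (Term.var (Sum.inr i))
  have hχ : ∀ x y : ι → M, χ.Realize (Sum.elim x y) ↔ x = y := fun x y => by
    simp [χ, Formula.realize_equal, funext_iff]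
  refine ⟨{φ | ∀ x y, E.r x y → φ.Realize (Sum.elim x y)}, fun x y =>
    ⟨fun h φ hφ => hφ x y h, fun h => ?_⟩⟩
  by_cases hxy : x = y
  · exact Or.inl hxy
  -- For finite tuples equality is one formula, so it can be split off as a disjunct.
  have hor : ∀ φ : L.Formula (ι ⊕ ι), (∀ (s h : M ≃[L] M), h ∈ Autf L M →
      φ.Realize (Sum.elim (s ∘ a) (h ∘ s ∘ a))) → φ.Realize (Sum.elim x y) := by
    intro φ hφ
    have := h (χ ⊔ φ) (by
      rintro x' y' (h | ⟨s, rfl, h, hh, rfl⟩)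
      · rw [Formula.realize_sup, hχ]
        exact Or.inl h
      · rw [Formula.realize_sup]
        exact Or.inr (hφ s h hh))
    rw [Formula.realize_sup, hχ] at this
    exact this.resolve_left hxy
  have hax : SameType L a x := .of_imp fun φ hφ => by
    have := hor (φ.relabel Sum.inl) fun s h _ => by
      rw [Formula.realize_relabel, Sum.elim_comp_inl]
      exact (SameType.aut s a φ).2 hφ
    rwa [Formula.realize_relabel, Sum.elim_comp_inl] at this
  obtain ⟨s, rfl⟩ := hsat.exists_aut_of_continuum_lt hM hax
  obtain ⟨y, rfl⟩ : ∃ z, s ∘ z = y :=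
    ⟨(s⁻¹ : M ≃[L] M) ∘ y, funext fun k => aut_apply_inv_self s (y k)⟩
  have hy : ∀ φ : L.Formula (ι ⊕ ι), φ.Realize (Sum.elim a y) →
      ∃ h ∈ Autf L M, φ.Realize (Sum.elim a (h ∘ a)) := by
    intro φ hφ
    by_contra! hcon
    have := hor φ.not fun s' h hh => by
      have h1 := hcon (s'⁻¹ * h * s') (by
        simpa using (autf_normal (L := L) (M := M)).conj_mem h hh s'⁻¹)
      rw [← SameType.aut s' _ φ, Sum.comp_elim, show s' ∘ (s'⁻¹ * h * s' : M ≃[L] M) ∘ a =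
        h ∘ s' ∘ a from funext fun k => aut_apply_inv_self s' (h (s' (a k)))] at h1
      exact h1
    rw [← Sum.comp_elim, SameType.aut s _ φ.not] at this
    exact this hφ
  obtain ⟨U, k, hk, hU⟩ := exists_limAt_of_directed hsat hM n
    (fun φ : L.Formula (ι ⊕ ι) => φ.Realize (Sum.elim a y))
    (fun φ => {h | h ∈ Autf L M ∧ φ.Realize (Sum.elim a (h ∘ a))}) ⟨⊤, by simp⟩
    (fun φ ψ hφ hψ => ⟨φ ⊓ ψ, by simp [hφ, hψ], by
      rintro f ⟨hf, h⟩
      rw [Formula.realize_inf] at h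
      exact ⟨⟨hf, h.1⟩, hf, h.2⟩⟩)
    (fun φ hφ => hy φ hφ)
  have hkf : k ∈ Autf L M := Gal.mk_eq_one_iff.1 <| mk_mem_of_isClosed hsat hM hcl hn hk <|
    Filter.mem_of_superset (hU ⊤ (by simp)) fun f hf => Gal.mk_eq_one_iff.2 hf.1
  have hlim : TypeLim L U (fun f : M ≃[L] M => Sum.elim a (f ∘ a)) (Sum.elim a (k ∘ a)) := by
    have := (hk.typeLim_comp σ).comp Sum.swap
    have e : ∀ f : M ≃[L] M, Sum.elim (f ∘ n ∘ σ) (n ∘ σ) ∘ Sum.swap = Sum.elim a (f ∘ a) :=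
      fun f => by funext k; rcases k with k | k <;> rfl
    simpa only [id, e] using this
  have hsame : SameType L (Sum.elim a y) (Sum.elim a (k ∘ a)) := .of_imp fun φ hφ =>
    (hlim φ).2 (Filter.mem_of_superset (hU φ hφ) fun f hf => hf.2)
  obtain ⟨t, ht⟩ := hsat.exists_aut_of_continuum_lt hM hsame.symm
  rw [Sum.comp_elim, Sum.elim_eq_iff] at ht
  obtain ⟨ht1, rfl⟩ := ht
  refine Or.inr ⟨s, rfl, (s * t) * k * (s * t)⁻¹, autf_normal.conj_mem k hkf _, ?_⟩
  nth_rewrite 1 [← ht1]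
  exact funext fun i => congrArg (fun z => s (t (k z))) (aut_inv_apply_self (s * t) (a i))

theorem faithfulOnFinitary_of_isClosed_one [Countable L.Symbols] (hsat : IsSaturated L M)
    (hM : 𝔠 < #M) (hcl : IsClosed ({1} : Set (Gal L M))) :
    FaithfulOnFinitaryBddHyperimaginaries L M := by
  classical
  intro γ hγ
  obtain ⟨n, hn, -⟩ := exists_isModelTuple (L := L) (aleph0_lt_continuum.trans hM).le
    (Empty.elim : Empty → M)
  obtain ⟨g, rfl⟩ := Gal.mk_surjective γ
  refine ((isClosed_iff_isUltraClosed hsat hM).1 hcl).mk_mem hsat hM hn fun θ hθ => ?_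
  -- A formula sees only a finite part `a` of the image of `n`. As the class of `a` is fixed, some
  -- strong `h` agrees with `g` on `a`.
  let F := θ.freeVarFinset.toLeft
  let a : F → M := n ∘ Subtype.val
  let E := lascarEquivOn (L := L) a
  have hb : InvEquiv.IsBoundedElt (E.cls a) :=
    isBoundedElt_of_autf_smul_eq hsat hM fun f hf => by
      rw [InvEquiv.smul_cls, eq_comm, InvEquiv.cls_eq_iff]
      exact Or.inr ⟨1, rfl, f, hf, rfl⟩
  have h1 := hγ F E (lascarEquivOn_isTypeDefinable hsat hM hcl hn _) (E.cls a) hb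
  rw [galAct_mk_cls_eq_iff hsat hM hb] at h1
  obtain ⟨h, hh, hha⟩ : ∃ h ∈ Autf L M, h ∘ a = g ∘ a := by
    rcases E.iseqv.symm h1 with h | ⟨-, -, h, hh, heq⟩
    · exact ⟨1, one_mem _, h⟩
    · exact ⟨h, hh, heq⟩
  refine (Formula.realize_congr ?_).1 (hθ h (Gal.mk_eq_one_iff.2 hh))
  rintro (i | i) hi
  · exact congrFun hha ⟨i, by simpa [F] using hi⟩
  · rfl

/-- A clopen set of `Gal` is given by one formula. -/
theorem exists_formula_of_isClopen [Countable L.Symbols] (hsat : IsSaturated L M) (hM : 𝔠 < #M)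
    {V : Set (Gal L M)} (hV : IsClopen V) {n : ℕ → M} (hn : IsModelTuple L n) :
    ∃ φ : L.Formula (ℕ ⊕ ℕ), ∀ f : M ≃[L] M,
      Gal.mk f ∈ V ↔ φ.Realize (Sum.elim (f ∘ n) n) := by
  by_contra! hcon
  obtain ⟨U, k, hk, hU⟩ := exists_limAt_of_directed hsat hM n
    (fun θ : L.Formula (ℕ ⊕ ℕ) =>
      ∀ h : M ≃[L] M, Gal.mk h ∈ V → θ.Realize (Sum.elim (h ∘ n) n))
    (fun θ => {f | Gal.mk f ∈ Vᶜ ∧ θ.Realize (Sum.elim (f ∘ n) n)})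
    ⟨⊤, by simp⟩
    (fun θ θ' h h' => ⟨θ ⊓ θ', fun f hf => by
        rw [Formula.realize_inf]
        exact ⟨h f hf, h' f hf⟩, by
      rintro f ⟨hf, h2⟩
      rw [Formula.realize_inf] at h2
      exact ⟨⟨hf, h2.1⟩, hf, h2.2⟩⟩)
    (fun θ hθ => by
      obtain ⟨f, hf⟩ := hcon θ
      rcases hf with hf | hf
      · exact (hf.2 (hθ f hf.1)).elim
      · exact ⟨f, hf⟩)
  refine mk_mem_of_isClosed hsat hM hV.isOpen.isClosed_compl hn hk
    (Filter.mem_of_superset (hU ⊤ (by simp)) fun f hf => hf.1) ?_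
  exact ((isClosed_iff_isUltraClosed hsat hM).1 hV.isClosed).mk_mem hsat hM hn fun θ hθ =>
    (hk θ).2 (Filter.mem_of_superset (hU θ hθ) fun f hf => hf.2)

/-- Tuples have the same traces of a formula on the realizations of `ψ`. -/
def traceEquiv {ι : Type} (φ : L.Formula (ι ⊕ ι)) (ψ : L.Formula ι) : InvEquiv L M ι where
  r x y := ∀ z, ψ.Realize z → (φ.Realize (Sum.elim x z) ↔ φ.Realize (Sum.elim y z))
  iseqv := ⟨fun x z _ => Iff.rfl, fun h z hz => (h z hz).symm,
    fun h h' z hz => (h z hz).trans (h' z hz)⟩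
  invariant := by
    intro f x y h z hz
    obtain ⟨z, rfl⟩ : ∃ z', f ∘ z' = z :=
      ⟨(f⁻¹ : M ≃[L] M) ∘ z, funext fun k => aut_apply_inv_self f (z k)⟩
    rw [← Sum.comp_elim, ← Sum.comp_elim, SameType.aut f _ φ, SameType.aut f _ φ]
    exact h z ((SameType.aut f _ ψ).1 hz)

theorem traceEquiv_isDefinable {ι : Type} [Finite ι] (φ : L.Formula (ι ⊕ ι)) (ψ : L.Formula ι) :
    (traceEquiv (M := M) φ ψ).IsDefinable := by
  refine ⟨Formula.iAlls ι ((ψ.relabel Sum.inr).imp ((φ.relabel (Sum.map Sum.inl id)).iff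
    (φ.relabel (Sum.map Sum.inr id)))), fun x y => ?_⟩
  rw [Formula.realize_iAlls]
  refine forall_congr' fun z => ?_
  rw [Formula.realize_imp, Formula.realize_iff, Formula.realize_relabel, Formula.realize_relabel,
    Formula.realize_relabel]
  simp only [Function.comp_def]
  refine imp_congr Iff.rfl (iff_congr ?_ ?_)
  · rw [show (fun k => Sum.elim (Sum.elim x y) z (Sum.map Sum.inl id k)) = Sum.elim x z from by
      funext k; rcases k with k | k <;> rfl]
  · rw [show (fun k => Sum.elim (Sum.elim x y) z (Sum.map Sum.inr id k)) = Sum.elim y z from by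
      funext k; rcases k with k | k <;> rfl]

/-- An open subgroup contains the stabilizer of a bounded imaginary element. -/
theorem exists_imaginary_of_isOpen [Countable L.Symbols] (hsat : IsSaturated L M) (hM : 𝔠 < #M)
    {V : Subgroup (Gal L M)} (hV : IsClopen (V : Set (Gal L M))) :
    ∃ (ι : Type) (_ : Finite ι) (E : InvEquiv L M ι) (α : E.Classes), E.IsDefinable ∧
      InvEquiv.IsBoundedElt α ∧ ∀ γ : Gal L M, galAct γ α = α → γ ∈ V := by
  classical
  obtain ⟨n, hn, -⟩ := exists_isModelTuple (L := L) (aleph0_lt_continuum.trans hM).le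
    (Empty.elim : Empty → M)
  obtain ⟨φ, hφ⟩ := exists_formula_of_isClopen hsat hM hV hn
  -- Both halves of the formula are put on one finite tuple `a`, so that `θ` at (f a, g a) expresses
  -- membership of g⁻¹f in `V`.
  let F := φ.freeVarFinset.toLeft ∪ φ.freeVarFinset.toRight
  let a : F → M := n ∘ Subtype.val
  let τ : φ.freeVarFinset → F ⊕ F := fun k => match k with
    | ⟨Sum.inl i, hi⟩ => Sum.inl ⟨i, Finset.mem_union_left _ (Finset.mem_toLeft.2 hi)⟩
    | ⟨Sum.inr i, hi⟩ => Sum.inr ⟨i, Finset.mem_union_right _ (Finset.mem_toRight.2 hi)⟩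
  let θ : L.Formula (F ⊕ F) := φ.restrictVars.relabel τ
  have hθ : ∀ f g : M ≃[L] M, θ.Realize (Sum.elim (f ∘ a) (g ∘ a)) ↔
      (Gal.mk g)⁻¹ * Gal.mk f ∈ V := by
    intro f g
    rw [← Gal.mk_inv, ← Gal.mk_mul, ← SetLike.mem_coe, hφ, realize_comp_iff,
      ← Formula.realize_restrictVars φ, Formula.realize_relabel]
    rw [show (Sum.elim (f ∘ a) (g ∘ a) ∘ τ) =
      fun i : φ.freeVarFinset => (Sum.elim (f ∘ n) (g ∘ n)) i from by
        funext ⟨k, hk⟩; rcases k with k | k <;> rfl]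
  have hθ1 : ∀ f : M ≃[L] M, θ.Realize (Sum.elim (f ∘ a) a) ↔ Gal.mk f ∈ V := fun f => by
    have := hθ f 1
    rwa [Gal.mk_one, inv_one, one_mul] at this
  -- For conjugates z = g a the equivalence holds because g⁻¹h ∈ V iff g⁻¹ ∈ V when h ∈ V.
  -- Compactness replaces the full type of `a` by one formula `ψ`, so the trace relation becomes
  -- definable.
  obtain ⟨ψ, hψa, hψ⟩ : ∃ ψ : L.Formula F, ψ.Realize a ∧ ∀ (h : M ≃[L] M) (z : F → M),
      Gal.mk h ∈ V → ψ.Realize z →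
        (θ.Realize (Sum.elim (h ∘ a) z) ↔ θ.Realize (Sum.elim a z)) := by
    by_contra! hcon
    obtain ⟨U, hU⟩ := exists_ultrafilter_of_directed (fun ψ : L.Formula F => ψ.Realize a)
      (fun ψ => {p : (M ≃[L] M) × (F → M) | Gal.mk p.1 ∈ V ∧ ψ.Realize p.2 ∧
        ¬ (θ.Realize (Sum.elim (p.1 ∘ a) p.2) ↔ θ.Realize (Sum.elim a p.2))}) ⟨⊤, by simp⟩
      (fun ψ ψ' hψ hψ' => ⟨ψ ⊓ ψ', by simp [hψ, hψ'], by
        rintro p ⟨h1, h2, h3⟩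
        rw [Formula.realize_inf] at h2
        exact ⟨⟨h1, h2.1, h3⟩, h1, h2.2, h3⟩⟩)
      (fun ψ hψ => by
        obtain ⟨h, z, h1, h2, h3⟩ := hcon ψ hψ
        exact ⟨(h, z), h1, h2, by tauto⟩)
    have htop := hU ⊤ (by simp)
    obtain ⟨c, hc⟩ := hsat.exists_typeLim hM U (fun p => Sum.elim (p.1 ∘ a) p.2) a
    have hz : SameType L a (c ∘ Sum.inr) := .of_imp fun χ hχ => by
      have := hc.comp (Sum.inl ∘ Sum.inr)
      exact (this χ).2 (Filter.mem_of_superset (hU χ hχ) fun p hp => hp.2.1)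
    have hy : SameType L a (c ∘ Sum.inl) := by
      have h1 : TypeLim L U (fun p => p.1 ∘ a) a := .of_forall_sameType fun p => .aut p.1 a
      exact h1.sameType (hc.comp (Sum.inl ∘ Sum.inl))
    obtain ⟨g, hg⟩ := hsat.exists_aut_of_continuum_lt hM hz
    obtain ⟨f, hf⟩ := hsat.exists_aut_of_continuum_lt hM hy
    have h1 : Gal.mk f ∈ V := by
      rw [← hθ1, hf]
      have := hc.comp (Sum.map Sum.inl id)
      simp only [Sum.elim_comp_map, Sum.elim_comp_inl, Function.comp_id] at this
      exact (this θ).2 (Filter.mem_of_superset htop fun p hp => (hθ1 _).2 hp.1)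
    have h2 : ¬ (θ.Realize (Sum.elim (f ∘ a) (g ∘ a)) ↔ θ.Realize (Sum.elim a (g ∘ a))) := by
      rw [hf, hg]
      let χ : L.Formula ((F ⊕ F) ⊕ F) := (θ.relabel Sum.inl).iff
        (θ.relabel (Sum.elim Sum.inr fun i => Sum.inl (Sum.inr i)))
      have hχ : ∀ (x : F ⊕ F → M), χ.Realize (Sum.elim x a) ↔
          (θ.Realize (Sum.elim (x ∘ Sum.inl) (x ∘ Sum.inr)) ↔
            θ.Realize (Sum.elim a (x ∘ Sum.inr))) := by
        intro x
        rw [Formula.realize_iff, Formula.realize_relabel (φ := θ), Formula.realize_relabel (φ := θ),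
          Sum.elim_comp_inl, Sum.elim_comp_inl_inr]
        rw [show Sum.elim x a ∘ (Sum.elim Sum.inr fun i => Sum.inl (Sum.inr i)) =
          Sum.elim a (x ∘ Sum.inr) from by funext k; rcases k with k | k <;> rfl]
      have := hc.realize_of_eventually (φ := χ.not) (Filter.mem_of_superset htop fun p hp => by
        change ¬ χ.Realize _
        rw [hχ]
        exact hp.2.2)
      rw [← hχ]
      exact this
    refine h2 ?_
    have h3 := hθ 1 g
    rw [Gal.mk_one, mul_one] at h3
    rw [hθ, show Sum.elim a (g ∘ a) = Sum.elim ((1 : M ≃[L] M) ∘ a) (g ∘ a) from rfl, h3]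
    exact V.mul_mem_cancel_right h1
  let E := traceEquiv (M := M) θ ψ
  have hb : InvEquiv.IsBoundedElt (E.cls a) :=
    isBoundedElt_of_autf_smul_eq hsat hM fun f hf => by
      rw [InvEquiv.smul_cls, InvEquiv.cls_eq_iff]
      intro z hz
      refine hψ f z ?_ hz
      rw [Gal.mk_eq_one_iff.2 hf]
      exact one_mem _
  refine ⟨F, inferInstance, E, E.cls a, traceEquiv_isDefinable θ ψ, hb, fun γ hγ => ?_⟩
  obtain ⟨f, rfl⟩ := Gal.mk_surjective γ
  rw [galAct_mk_cls_eq_iff hsat hM hb] at hγ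
  -- Evaluating equal traces at z = a reduces membership of the class of `f` to that of 1.
  rw [← hθ1, hγ a hψa]
  exact (hθ1 1).2 (one_mem _)

theorem isProfinite_iff_faithfulOnBddImaginaries [Countable L.Symbols] (hsat : IsSaturated L M)
    (hM : 𝔠 < #M) : IsProfinite (Gal L M) ↔ FaithfulOnBddImaginaries L M := by
  have hgrp := gal_isTopologicalGroup hsat hM
  have hcpt := gal_compactSpace hsat hM
  constructor
  · rintro ⟨-, -, _, _⟩ γ hγ
    by_contra hne
    -- In a profinite group some open subgroup omits a given nontrivial element; it contains the
    -- stabilizer of a bounded imaginary.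
    obtain ⟨V, hV⟩ := ProfiniteGrp.exist_openNormalSubgroup_sub_open_nhds_of_one
      (G := Gal L M) (U := {γ}ᶜ) isClosed_singleton.isOpen_compl (by simpa [eq_comm] using hne)
    have hVc : IsClopen ((V : Subgroup (Gal L M)) : Set (Gal L M)) :=
      V.toOpenSubgroup.isClopen
    obtain ⟨ι, hι, E, α, hE, hα, hfix⟩ := exists_imaginary_of_isOpen hsat hM hVc
    exact hV (hfix γ (hγ ι E hE α hα)) rfl
  · intro h
    have h2 : T2Space (Gal L M) := t2Space_of_faithfulOnBddHyperimaginaries hsat hM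
      fun γ hγ => h γ fun ι _ E hE α hα => hγ ι E hE.isTypeDefinable α hα
    refine ⟨hgrp, hcpt, h2, ?_⟩
    refine @TotallySeparatedSpace.totallyDisconnectedSpace _ _
      (totallySeparatedSpace_iff_exists_isClopen.2 fun γ δ hne => ?_)
    have hne' : γ⁻¹ * δ ≠ 1 := fun h => hne (inv_mul_eq_one.1 h)
    have hex : ∃ (ι : Type) (_ : Finite ι) (E : InvEquiv L M ι) (_ : E.IsDefinable)
        (α : E.Classes), InvEquiv.IsBoundedElt α ∧ galAct (γ⁻¹ * δ) α ≠ α := by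
      by_contra! hcon
      exact hne' (h _ fun ι hι E hE α hα => hcon ι hι E hE α hα)
    obtain ⟨ι, hι, E, hE, α, hα, hmove⟩ := hex
    have hclopen : IsClopen {η : Gal L M | galAct η α = α} :=
      ⟨isClosed_setOf_galAct_eq hsat hM hE.isTypeDefinable hα,
        isOpen_setOf_galAct_eq hsat hM hE hα⟩
    -- The separating clopen set is the left coset by `γ` of the stabilizer.
    refine ⟨_, hclopen.preimage (continuous_const_mul γ⁻¹), ?_, hmove⟩
    change galAct (γ⁻¹ * γ) α = α
    rw [inv_mul_cancel, ← Gal.mk_one, galAct_mk hsat hM hα, one_smul]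

end Faithfulness

theorem theorem2 {L : FirstOrder.Language.{u, v}} [Countable L.Symbols] (T : L.Theory) (hT : T.IsComplete)
    (M : Type w) [L.Structure M] (hM : M ⊨ T) (hsat : IsSaturated L M) (hcard : 𝔠 < #M) :
    (∀ (ι : Type) [Countable ι] (E : InvEquiv L M ι) (α : E.Classes),
      InvEquiv.IsBoundedElt α → ∀ f : M ≃[L] M, galAct (Gal.mk f) α = f • α) ∧
    (∀ (I : Type w) (U : Ultrafilter I) (f : I → (M ≃[L] M)), ∃! β : Gal L M,
      IsUltraLimit U f β) ∧
    (∀ X : Set (Gal L M), IsClosed X ↔ IsUltraClosed X) ∧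
    (IsTopologicalGroup (Gal L M) ∧ CompactSpace (Gal L M)) ∧
    ((T2Space (Gal L M) ↔ FaithfulOnBddHyperimaginaries L M) ∧
      (T2Space (Gal L M) ↔ FaithfulOnFinitaryBddHyperimaginaries L M)) ∧
    (IsProfinite (Gal L M) ↔ FaithfulOnBddImaginaries L M) := by
  have h1 : T2Space (Gal L M) → FaithfulOnFinitaryBddHyperimaginaries L M := fun _ =>
    faithfulOnFinitary_of_isClosed_one hsat hcard isClosed_singleton
  have h2 : FaithfulOnFinitaryBddHyperimaginaries L M → FaithfulOnBddHyperimaginaries L M :=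
    fun h γ hγ => h γ fun ι _ E hE α hα => hγ ι E hE α hα
  have h3 : FaithfulOnBddHyperimaginaries L M → T2Space (Gal L M) :=
    t2Space_of_faithfulOnBddHyperimaginaries hsat hcard
  exact ⟨fun ι _ E α hα f => galAct_mk hsat hcard hα f,
    fun I U f => existsUnique_isUltraLimit hsat hcard U f,
    fun X => isClosed_iff_isUltraClosed hsat hcard,
    ⟨gal_isTopologicalGroup hsat hcard, gal_compactSpace hsat hcard⟩,
    ⟨⟨fun h => h2 (h1 h), h3⟩, ⟨h1, fun h => h3 (h2 h)⟩⟩,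
    isProfinite_iff_faithfulOnBddImaginaries hsat hcard⟩
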